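/- Let $(\varepsilon_i)_{i\in\mathbb Z}$ be i.i.d. real random variables with mean $0$ and variance $1$, having a density with respect to Lebesgue measure, and whose characteristic function $\psi$ satisfies $\int_{-\infty}^{\infty}|\psi(s)|^{\nu}\,ds<\infty$ for some $1\le\nu<\infty$. Let $(\phi_j)_{j\ge 0}$ be real numbers with $\sum_{j\ge 0}|\phi_j|<\infty$ and $\sum_{j\ge 0}\phi_j\neq 0$, and put $w_t=\sum_{j=0}^{\infty}\phi_j\varepsilon_{t-j}$ for $t\ge1$. Let $x_0$ be a real random variable independent of the process $(w_t)_{t\ge1}$, and let $x_t=x_{t-1}+w_t$ for integers $t\ge 1$. Let $\alpha\ge-2$ be real and let $(v_t)_{t\ge 1}$ be real random variables on the same probability space with $\sup_{t\ge1}E|v_t|<\infty$. Assume that, for all $t\ge1$, almost surely $E(|v_t|\mid x_t)=E|v_t|$ if $\alpha\ge0$, respectively $E(|v_t|\mid x_t-x_0)=E|v_t|$ if $-2\le\alpha<0$. Then almost surely $x_t\ne0$ for all $t\ge1$ (so that the sums below are almost surely well-defined), and, as $n\to\infty$, $$\sum_{t=1}^{n}|v_t|\,|x_t|^{-\alpha}=\begin{cases}O_P(n^{\alpha/2})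 & \text{if }\alpha>1,\\ O_P(n^{1/2}\log n) & \text{if }\alpha=1,\\ O_P(n^{1-\alpha/2}) & \text{if }-2\le\alpha<1,\end{cases}$$ and the same bounds hold for $\sum_{t=1}^{n}v_t|x_t|^{-\alpha}$. Here $Y_n=O_P(d_n)$ means that for every $\delta>0$ there is a finite $M$ with $P(|Y_n|>M d_n)<\delta$ for all sufficiently large $n$. -/

import Mathlib

open MeasureTheory ProbabilityTheory

section

variable {Ω : Type*}

/-- The linear process `w_t = ∑_{j ≥ 0} φ_j ε_{t-j}`. For absolutely summable `φ` and identically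
distributed integrable `ε_i` the series converges absolutely almost surely. -/
noncomputable def linearProcess (φ : ℕ → ℝ) (ε : ℤ → Ω → ℝ) (t : ℕ) (ω : Ω) : ℝ :=
  ∑' j : ℕ, φ j * ε ((t : ℤ) - (j : ℤ)) ω

/-- The integrated process with initial value `x₀`: the solution of `x_t = x_{t-1} + w_t`,
`t ≥ 1`. -/
noncomputable def integratedProcess (x₀ : Ω → ℝ) (w : ℕ → Ω → ℝ) : ℕ → Ω → ℝ
  | 0 => x₀
  | t + 1 => fun ω => integratedProcess x₀ w t ω + w (t + 1) ω

theorem measurable_linearProcess [MeasurableSpace Ω] (φ : ℕ → ℝ) {ε : ℤ → Ω → ℝ}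
    (hε : ∀ i, Measurable (ε i)) (t : ℕ) : Measurable (linearProcess φ ε t) :=
  Measurable.tsum fun j => (hε ((t : ℤ) - (j : ℤ))).const_mul (φ j)

theorem measurable_integratedProcess [MeasurableSpace Ω] {x₀ : Ω → ℝ} {w : ℕ → Ω → ℝ}
    (hx₀ : Measurable x₀) (hw : ∀ t, Measurable (w t)) (t : ℕ) :
    Measurable (integratedProcess x₀ w t) := by
  induction t with
  | zero => exact hx₀
  | succ t ih => exact ih.add (hw (t + 1))

/-- The defining series of the linear process converges absolutely almost surely. -/
theorem ae_summable_linearProcess [MeasurableSpace Ω] {μ : Measure Ω} {φ : ℕ → ℝ}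
    {ε : ℤ → Ω → ℝ} (hident : ∀ i, IdentDistrib (ε i) (ε 0) μ μ) (hint : Integrable (ε 0) μ)
    (hφ : Summable fun j => |φ j|) (t : ℕ) :
    ∀ᵐ ω ∂μ, Summable fun j : ℕ => |φ j * ε ((t : ℤ) - (j : ℤ)) ω| := by
  have hm : ∀ j : ℕ, AEMeasurable (fun ω => φ j * ε ((t : ℤ) - (j : ℤ)) ω) μ :=
    fun j => (hident _).aemeasurable_fst.const_mul _
  have hone : ∀ i, ∫⁻ ω, ‖ε i ω‖ₑ ∂μ = ∫⁻ ω, ‖ε 0 ω‖ₑ ∂μ := fun i =>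
    ((hident i).comp measurable_enorm).lintegral_eq
  have hfin : ∫⁻ ω, ∑' j : ℕ, ‖φ j * ε ((t : ℤ) - (j : ℤ)) ω‖ₑ ∂μ ≠ ⊤ := by
    rw [lintegral_tsum fun j => (hm j).enorm]
    have hj : ∀ j : ℕ, ∫⁻ ω, ‖φ j * ε ((t : ℤ) - (j : ℤ)) ω‖ₑ ∂μ
        = ‖φ j‖ₑ * ∫⁻ ω, ‖ε 0 ω‖ₑ ∂μ := by
      intro j
      simp_rw [enorm_mul]
      rw [lintegral_const_mul' _ _ enorm_ne_top, hone]
    simp_rw [hj]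
    rw [ENNReal.tsum_mul_right]
    refine ENNReal.mul_ne_top ?_ hint.2.ne
    simp only [enorm_eq_nnnorm]
    rw [ENNReal.tsum_coe_ne_top_iff_summable, ← NNReal.summable_coe]
    exact hφ
  filter_upwards [ae_lt_top' (AEMeasurable.tsum fun j => (hm j).enorm) hfin] with ω hω
  have h2 := hω.ne
  simp only [enorm_eq_nnnorm] at h2
  rw [ENNReal.tsum_coe_ne_top_iff_summable, ← NNReal.summable_coe] at h2
  exact h2

/-- `Y_n = O_P(d_n)` as `n → ∞`: for every `δ > 0` there is `M` such that
`P(|Y_n| > M |d_n|) < δ` for all large `n`. -/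
def IsBigOInProbability [MeasurableSpace Ω] (μ : Measure Ω) (Y : ℕ → Ω → ℝ) (d : ℕ → ℝ) : Prop :=
  ∀ δ : ℝ, 0 < δ → ∃ M : ℝ, 0 < M ∧ ∃ N : ℕ, ∀ n : ℕ, N ≤ n →
    μ {ω | M * |d n| < |Y n ω|} < ENNReal.ofReal δ

/-- The rate `n^{α/2}` if `α > 1`, `n^{1/2} log n` if `α = 1`, and `n^{1-α/2}` if `α < 1`. -/
noncomputable def powerSumRate (α : ℝ) (n : ℕ) : ℝ :=
  if 1 < α then (n : ℝ) ^ (α / 2)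
  else if α = 1 then (n : ℝ) ^ (1 / 2 : ℝ) * Real.log n
  else (n : ℝ) ^ (1 - α / 2)

end

/-!
Write `x_t = x₀ + S_t` with `S_t = w_1 + ⋯ + w_t`. Everything rests on two facts about `S_t`.

*Density bound.* For large `t` the law of `S_t` is at most `K / √t` times Lebesgue measure
(`exists_map_sum_linearProcess_le`), and so is that of `x_t`, as convolution preserves such a
bound. The coefficient of `ε_i` in `S_t` is `φ_0 + ⋯ + φ_{t-i}` for `1 ≤ i ≤ t`; for
`i ≤ t - m₀` it is bounded away from zero. These innovations are split off from an independent
rest, and the law of their combination is bounded by the integral of its characteristic function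
(`measure_le_integral_norm_charFun_smul_volume`). By the arithmetic-geometric mean inequality the
integral of the product `∏ |ψ(a_i s)|` of `N` factors is at most a constant times `∫ |ψ|^N`
(`integral_prod_comp_mul_le`), which is `O(N^{-1/2})`: near the origin `|ψ(s)| ≤ exp(-s²/4)`, and
away from it `|ψ| ≤ η < 1`, because `ε_0` has a density
(`exists_integral_norm_charFun_pow_le`).

*Second moment.* `E S_t² ≤ (∑ |φ_j|)² t`, by Cauchy-Schwarz applied to
`S_t = ∑_j φ_j (ε_{1-j} + ⋯ + ε_{t-j})` (`lintegral_sq_sum_linearProcess_le`).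

If `α ≥ 0`, the density bound makes all `|x_t|`, `t₀ ≤ t ≤ n`, exceed `κ = e / √n` outside an event
of probability `O(e)`. Since `E(|v_t| ∣ x_t)` is constant, the expectation of
`|v_t| |x_t|^{-α} 1{|x_t| > κ}` factorizes, and the second factor is at most
`(K / √t) ∫_{κ < |y| ≤ √n} |y|^{-α} dy + n^{-α/2}`. Summing over `t ≤ n` with `∑ t^{-1/2} ≤ 2 √n`
gives the rate in each of the three ranges of `α`, and Markov's inequality concludes
(`isBigOInProbability_sum_of_nonneg`). If `α < 0`, then `|x_t|^{-α}` is at most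
`n^{-α/2} (1 + x_t² / n)`, and the second moment bound suffices on an event where `x₀` is bounded
(`isBigOInProbability_sum_of_neg`).
-/

open Filter Topology
open scoped ENNReal NNReal

/-! ### Bounded densities from integrable characteristic functions -/

/-- Domination by a multiple of Lebesgue measure may be tested on closed balls, by the Besicovitch
covering theorem. -/
theorem measure_le_smul_volume_of_closedBall {ρ : Measure ℝ} [SFinite ρ] {K : ℝ≥0}
    (h : ∀ a r : ℝ, 0 < r → ρ (Metric.closedBall a r) ≤ K * volume (Metric.closedBall a r)) :
    ρ ≤ K • (volume : Measure ℝ) := by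
  refine Measure.le_intro fun s _ _ => ?_
  refine (Besicovitch.vitaliFamily ρ).measure_le_of_frequently_le _
    Measure.AbsolutelyContinuous.rfl s fun a _ => ?_
  refine (Besicovitch.tendsto_filterAt ρ a).frequently (Eventually.frequently ?_)
  filter_upwards [self_mem_nhdsWithin] with r hr
  exact h a r hr

/-- The indicator of the ball is at most twice the Gaussian bump `exp (-(x - a)² / (2 r²))`, which
is itself a characteristic function; Fubini moves the integral to the characteristic function of
`ρ`. -/
theorem measure_closedBall_le_integral_norm_charFun {ρ : Measure ℝ} [IsProbabilityMeasure ρ]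
    (hint : Integrable (charFun ρ)) (a : ℝ) {r : ℝ} (hr : 0 < r) :
    ρ.real (Metric.closedBall a r) ≤ 2 * r * ∫ s, ‖charFun ρ s‖ := by
  set v : ℝ≥0 := ⟨(r ^ 2)⁻¹, by positivity⟩ with hv
  have hvr : (v : ℝ) = (r ^ 2)⁻¹ := rfl
  have hv0 : v ≠ 0 := by
    intro h0
    have : (v : ℝ) = 0 := by rw [h0]; rfl
    rw [hvr] at this
    have : 0 < (r ^ 2)⁻¹ := by positivity
    linarith
  -- `exp (-z² / (2 r²))` is the characteristic function of the centred Gaussian of variance `r⁻²`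
  have hg : ∀ z : ℝ, charFun (gaussianReal 0 v) z = (Real.exp (-(z ^ 2 / (2 * r ^ 2))) : ℝ) := by
    intro z
    rw [charFun_gaussianReal, hvr]
    push_cast
    congr 1
    field_simp
    ring
  have hgi : Integrable (fun x : ℝ => Real.exp (-((x - a) ^ 2 / (2 * r ^ 2)))) ρ := by
    refine Integrable.of_bound (by fun_prop) 1 (ae_of_all _ fun x => ?_)
    rw [Real.norm_of_nonneg (Real.exp_pos _).le, Real.exp_le_one_iff]
    have : 0 ≤ (x - a) ^ 2 / (2 * r ^ 2) := by positivity
    linarith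
  have h1 : ρ.real (Metric.closedBall a r)
      ≤ ∫ x, 2 * Real.exp (-((x - a) ^ 2 / (2 * r ^ 2))) ∂ρ := by
    rw [← integral_indicator_one Metric.isClosed_closedBall.measurableSet]
    refine integral_mono_of_nonneg (ae_of_all _ fun x => Set.indicator_nonneg (by simp) _)
      (hgi.const_mul 2) (ae_of_all _ fun x => ?_)
    by_cases hx : x ∈ Metric.closedBall a r
    · simp only [hx, Set.indicator_of_mem, Pi.one_apply]
      rw [Metric.mem_closedBall, Real.dist_eq] at hx
      have h2 : (x - a) ^ 2 ≤ r ^ 2 := sq_le_sq' (by linarith [neg_le_of_abs_le hx])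
        (le_of_abs_le hx)
      have h3 : (x - a) ^ 2 / (2 * r ^ 2) ≤ 1 / 2 := by
        rw [div_le_iff₀ (by positivity)]; linarith
      have := Real.add_one_le_exp (-((x - a) ^ 2 / (2 * r ^ 2)))
      linarith
    · simp only [hx, not_false_eq_true, Set.indicator_of_notMem]
      positivity
  have h2 : ((∫ x, Real.exp (-((x - a) ^ 2 / (2 * r ^ 2))) ∂ρ : ℝ) : ℂ)
      = ∫ s, charFun ρ s * Complex.exp (-(s * a * Complex.I)) ∂(gaussianReal 0 v) := by
    rw [← integral_complex_ofReal]
    have : ∀ x : ℝ, ((Real.exp (-((x - a) ^ 2 / (2 * r ^ 2))) : ℝ) : ℂ)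
        = ∫ s : ℝ, Complex.exp (s * x * Complex.I) * Complex.exp (-(s * a * Complex.I))
          ∂(gaussianReal 0 v) := by
      intro x
      rw [← hg, charFun_apply_real]
      refine integral_congr_ae (ae_of_all _ fun s => ?_)
      simp only
      rw [← Complex.exp_add]
      congr 1
      push_cast
      ring
    simp_rw [this]
    rw [integral_integral_swap]
    · refine integral_congr_ae (ae_of_all _ fun s => ?_)
      simp only
      rw [integral_mul_const, charFun_apply_real]
    · refine Integrable.of_bound ?_ 1 (ae_of_all _ fun p => ?_)
      · refine Continuous.aestronglyMeasurable ?_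
        unfold Function.uncurry
        fun_prop
      · simp only [Function.uncurry, norm_mul]
        rw [← neg_mul, ← Complex.ofReal_mul, ← Complex.ofReal_mul, ← Complex.ofReal_neg,
          Complex.norm_exp_ofReal_mul_I, Complex.norm_exp_ofReal_mul_I, mul_one]
  have h3 : ∫ x, Real.exp (-((x - a) ^ 2 / (2 * r ^ 2))) ∂ρ ≤ r * ∫ s, ‖charFun ρ s‖ := by
    have hnn : 0 ≤ ∫ x, Real.exp (-((x - a) ^ 2 / (2 * r ^ 2))) ∂ρ :=
      integral_nonneg fun x => (Real.exp_pos _).le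
    rw [← Real.norm_of_nonneg hnn, ← Complex.norm_real, h2]
    refine (norm_integral_le_integral_norm _).trans ?_
    have h4 : ∀ s : ℝ, ‖charFun ρ s * Complex.exp (-(s * a * Complex.I))‖ = ‖charFun ρ s‖ := by
      intro s
      rw [norm_mul, ← neg_mul, ← Complex.ofReal_mul, ← Complex.ofReal_neg,
        Complex.norm_exp_ofReal_mul_I, mul_one]
    simp_rw [h4]
    rw [integral_gaussianReal_eq_integral_smul hv0, ← integral_const_mul]
    refine integral_mono_of_nonneg (ae_of_all _ fun s => ?_) (hint.norm.const_mul r)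
      (ae_of_all _ fun s => ?_)
    · exact smul_nonneg (gaussianPDFReal_nonneg _ _ _) (norm_nonneg _)
    · simp only [smul_eq_mul]
      refine mul_le_mul_of_nonneg_right ?_ (norm_nonneg _)
      rw [gaussianPDFReal, hvr]
      have e1 : Real.exp (-(s - 0) ^ 2 / (2 * (r ^ 2)⁻¹)) ≤ 1 := by
        rw [Real.exp_le_one_iff, neg_div]
        have : 0 ≤ (s - 0) ^ 2 / (2 * (r ^ 2)⁻¹) := by positivity
        linarith
      have e2 : (√(2 * Real.pi * (r ^ 2)⁻¹))⁻¹ ≤ r := by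
        rw [inv_le_comm₀ (by positivity) hr]
        refine Real.le_sqrt_of_sq_le ?_
        rw [inv_pow]
        have := Real.pi_gt_three
        have : 0 < (r ^ 2)⁻¹ := by positivity
        nlinarith
      calc _ ≤ r * 1 := mul_le_mul e2 e1 (Real.exp_pos _).le hr.le
        _ = r := mul_one r
  rw [integral_const_mul] at h1
  linarith

/-- A crude form of Fourier inversion: an integrable characteristic function forces a density
bounded by the integral of its modulus. (The sharp constant would be smaller by a factor `2π`.) -/
theorem measure_le_integral_norm_charFun_smul_volume {ρ : Measure ℝ} [IsProbabilityMeasure ρ]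
    (hint : Integrable (charFun ρ)) :
    ρ ≤ (∫ s, ‖charFun ρ s‖).toNNReal • (volume : Measure ℝ) := by
  refine measure_le_smul_volume_of_closedBall fun a r hr => ?_
  have h := measure_closedBall_le_integral_norm_charFun hint a hr
  rw [Real.volume_closedBall, ← ENNReal.ofReal_toReal (measure_ne_top ρ _), mul_comm]
  change ENNReal.ofReal _ ≤ _ * ENNReal.ofReal _
  rw [← ENNReal.ofReal_mul (by positivity)]
  exact ENNReal.ofReal_le_ofReal h

/-- If `|ψ(u)| = 1` with `u ≠ 0`, the law lives on a lattice, which is a null set. -/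
theorem norm_charFun_lt_one {ρ : Measure ℝ} [IsProbabilityMeasure ρ] (hρ : ρ ≪ volume) {u : ℝ}
    (hu : u ≠ 0) : ‖charFun ρ u‖ < 1 := by
  refine lt_of_le_of_ne (norm_charFun_le_one u) fun h => ?_
  set θ := (charFun ρ u).arg
  have h1 : ∫ x : ℝ, (1 - Real.cos (u * x - θ)) ∂ρ = 0 := by
    have e : charFun ρ u * Complex.exp (-(θ * Complex.I)) = 1 := by
      conv_lhs => rw [← Complex.norm_mul_exp_arg_mul_I (charFun ρ u), h]
      rw [Complex.ofReal_one, one_mul, ← Complex.exp_add, add_neg_cancel, Complex.exp_zero]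
    rw [charFun_apply_real, ← integral_mul_const] at e
    have hi : Integrable (fun x : ℝ => Complex.exp (u * x * Complex.I)
        * Complex.exp (-(θ * Complex.I))) ρ := by
      refine Integrable.of_bound (by fun_prop) 1 (ae_of_all _ fun x => ?_)
      rw [norm_mul, ← neg_mul, ← Complex.ofReal_mul, ← Complex.ofReal_neg,
          Complex.norm_exp_ofReal_mul_I, Complex.norm_exp_ofReal_mul_I, mul_one]
    have e2 := congrArg Complex.re e
    rw [← RCLike.re_eq_complex_re, ← integral_re hi] at e2
    have e3 : ∀ x : ℝ, RCLike.re (Complex.exp (u * x * Complex.I)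
        * Complex.exp (-(θ * Complex.I))) = Real.cos (u * x - θ) := by
      intro x
      rw [← Complex.exp_add, ← neg_mul, ← add_mul, RCLike.re_eq_complex_re,
        ← Complex.exp_ofReal_mul_I_re]
      push_cast
      rw [sub_eq_add_neg]
    simp_rw [e3] at e2
    rw [integral_sub (integrable_const _), e2]
    · simp
    · refine Integrable.of_bound (by fun_prop) 1 (ae_of_all _ fun x => ?_)
      exact Real.abs_cos_le_one _
  rw [integral_eq_zero_iff_of_nonneg (fun x => sub_nonneg.2 (Real.cos_le_one _))] at h1
  swap
  · refine Integrable.of_bound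
      (continuous_const.sub (by fun_prop)).aestronglyMeasurable 2
      (ae_of_all _ fun x => ?_)
    have := Real.neg_one_le_cos (u * x - θ)
    have := Real.cos_le_one (u * x - θ)
    rw [Real.norm_of_nonneg (by linarith)]; linarith
  -- the phase `u x - θ` lies in `2πℤ`, so `x` lies in a countable set
  have h2 : ∀ᵐ x ∂ρ, x ∈ Set.range fun k : ℤ => (k * (2 * Real.pi) + θ) / u := by
    filter_upwards [h1] with x hx
    simp only [Pi.zero_apply, sub_eq_zero] at hx
    obtain ⟨k, hk⟩ := (Real.cos_eq_one_iff _).1 hx.symm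
    refine ⟨k, ?_⟩
    simp only
    rw [hk]; field_simp; ring
  have h3 : ρ (Set.range fun k : ℤ => (k * (2 * Real.pi) + θ) / u) = 0 :=
    hρ ((Set.countable_range _).measure_zero _)
  have h4 : ∀ᵐ x ∂ρ, False := by
    filter_upwards [h2, measure_eq_zero_iff_ae_notMem.1 h3] with x h h' using h' h
  exact (IsProbabilityMeasure.ne_zero ρ) (by simpa using h4)

/-- The Riemann-Lebesgue lemma for absolutely continuous laws. -/
theorem tendsto_charFun_cocompact {ρ : Measure ℝ} [IsFiniteMeasure ρ] (hρ : ρ ≪ volume) :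
    Tendsto (charFun ρ) (cocompact ℝ) (𝓝 0) := by
  have h := Real.tendsto_integral_exp_smul_cocompact
    (fun x => ((ρ.rnDeriv volume x).toReal : ℂ))
  have hlin : Tendsto (fun u : ℝ => -(2 * Real.pi)⁻¹ * u) (cocompact ℝ) (cocompact ℝ) :=
    (Homeomorph.mulLeft₀ (-(2 * Real.pi)⁻¹)
      (by simp [Real.pi_ne_zero])).isClosedEmbedding.tendsto_cocompact
  refine (h.comp hlin).congr fun u => ?_
  rw [Function.comp_apply, charFun_apply_real, ← integral_rnDeriv_smul hρ]
  refine integral_congr_ae (ae_of_all _ fun x => ?_)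
  simp only [Circle.smul_def, Real.fourierChar_apply, smul_eq_mul, Complex.real_smul]
  rw [mul_comm]
  congr 2
  push_cast
  field_simp

theorem exists_norm_charFun_le_of_le_abs {ρ : Measure ℝ} [IsProbabilityMeasure ρ]
    (hρ : ρ ≪ volume) {d : ℝ} (hd : 0 < d) :
    ∃ η : ℝ, 0 ≤ η ∧ η < 1 ∧ ∀ u : ℝ, d ≤ |u| → ‖charFun ρ u‖ ≤ η := by
  have h0 := (tendsto_charFun_cocompact hρ).norm
  rw [norm_zero] at h0
  have h1 := h0.eventually (ge_mem_nhds (show (0 : ℝ) < 1 / 2 by norm_num))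
  rw [Filter.Eventually, mem_cocompact] at h1
  obtain ⟨t, ht, hts⟩ := h1
  have hc : IsCompact (t ∩ {u : ℝ | d ≤ |u|}) :=
    ht.inter_right (isClosed_le continuous_const continuous_abs)
  have hcont : Continuous fun u => ‖charFun ρ u‖ := continuous_charFun.norm
  have hne : ∃ η : ℝ, η < 1 ∧ ∀ u ∈ t ∩ {u : ℝ | d ≤ |u|}, ‖charFun ρ u‖ ≤ η := by
    rcases (t ∩ {u : ℝ | d ≤ |u|}).eq_empty_or_nonempty with he | he
    · exact ⟨0, one_pos, by simp [he]⟩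
    · obtain ⟨u, hu, hmax⟩ := hc.exists_isMaxOn he hcont.continuousOn
      refine ⟨‖charFun ρ u‖, norm_charFun_lt_one hρ ?_, fun w hw => hmax hw⟩
      rintro rfl
      have := hu.2
      simp only [Set.mem_ofPred_eq, abs_zero] at this
      linarith
  obtain ⟨η, hη, hle⟩ := hne
  refine ⟨max η (1 / 2), by positivity, max_lt hη (by norm_num), fun u hu => ?_⟩
  by_cases hut : u ∈ t
  · exact (hle u ⟨hut, hu⟩).trans (le_max_left _ _)
  · exact (hts hut : _ ≤ _).trans (le_max_right _ _)

/-- Gaussian decay near the origin, from the second-order expansion `ψ(u) = 1 - u²/2 + o(u²)`. -/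
theorem eventually_norm_charFun_le_exp {Ω : Type*} [MeasurableSpace Ω] {μ : Measure Ω}
    [IsProbabilityMeasure μ] {X : Ω → ℝ} (hX : AEMeasurable X μ) (h0 : ∫ ω, X ω ∂μ = 0)
    (h1 : ∫ ω, (X ^ 2) ω ∂μ = 1) :
    ∀ᶠ u in 𝓝 (0 : ℝ), ‖charFun (μ.map X) u‖ ≤ Real.exp (-(1 / 4) * u ^ 2) := by
  have h := (taylor_charFun_two hX h0 h1).bound (show (0 : ℝ) < 1 / 4 by norm_num)
  have hs : ∀ᶠ u in 𝓝 (0 : ℝ), u ^ 2 < 2 :=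
    ((continuous_pow 2).tendsto (0 : ℝ)).eventually_lt_const (by norm_num)
  filter_upwards [h, hs] with u hu hu2
  rw [Real.norm_of_nonneg (sq_nonneg u)] at hu
  have e1 : ‖(1 - (u : ℂ) ^ 2 / 2)‖ = 1 - u ^ 2 / 2 := by
    rw [← Real.norm_of_nonneg (show (0 : ℝ) ≤ 1 - u ^ 2 / 2 by linarith), ← Complex.norm_real]
    push_cast
    rfl
  have e2 := norm_sub_norm_le (charFun (μ.map X) u) (1 - (u : ℂ) ^ 2 / 2)
  have e3 := Real.add_one_le_exp (-(1 / 4) * u ^ 2)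
  linarith

/-! ### Powers and products of characteristic functions -/

/-- `∫ |ψ|^N = O(N^{-1/2})`: compare with a Gaussian near the origin and with the geometrically
small `η^{N-k} |ψ|^ν`, `k = ⌈ν⌉`, away from it. -/
theorem exists_integral_norm_charFun_pow_le {Ω : Type*} [MeasurableSpace Ω] {μ : Measure Ω}
    [IsProbabilityMeasure μ] {X : Ω → ℝ} (hX : AEMeasurable X μ) (h0 : ∫ ω, X ω ∂μ = 0)
    (h1 : ∫ ω, (X ^ 2) ω ∂μ = 1) (hac : μ.map X ≪ volume) {ν : ℝ} (hν : 0 ≤ ν)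
    (hint : Integrable fun s : ℝ => ‖charFun (μ.map X) s‖ ^ ν) :
    ∃ C : ℝ, 0 < C ∧ ∃ N₀ : ℕ, ∀ N : ℕ, N₀ ≤ N →
      Integrable (fun s : ℝ => ‖charFun (μ.map X) s‖ ^ N) ∧
        ∫ s : ℝ, ‖charFun (μ.map X) s‖ ^ N ≤ C / √N := by
  have : IsProbabilityMeasure (μ.map X) := Measure.isProbabilityMeasure_map hX
  set ψ := charFun (μ.map X)
  obtain ⟨d, hd, hdψ⟩ := Metric.eventually_nhds_iff.1 (eventually_norm_charFun_le_exp hX h0 h1)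
  obtain ⟨η, hη0, hη1, hη⟩ := exists_norm_charFun_le_of_le_abs hac hd
  obtain ⟨D, hD⟩ := (tendsto_self_mul_const_pow_of_lt_one hη0 hη1).bddAbove_range
  set k := ⌈ν⌉₊
  have hD0 : 0 ≤ D := by simpa using hD ⟨0, rfl⟩
  set I := ∫ s : ℝ, ‖ψ s‖ ^ ν
  have hI : 0 ≤ I := integral_nonneg fun s => by positivity
  refine ⟨√(4 * Real.pi) + (D + k) * I, by positivity, k + 1, fun N hN => ?_⟩
  have hN0 : (1 : ℝ) ≤ N := by exact_mod_cast (by omega : 1 ≤ N)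
  have hpt : ∀ s : ℝ, ‖ψ s‖ ^ N ≤ Real.exp (-(N / 4) * s ^ 2) + η ^ (N - k) * ‖ψ s‖ ^ ν := by
    intro s
    rcases lt_or_ge |s| d with hs | hs
    · have h2 : ‖ψ s‖ ≤ Real.exp (-(1 / 4) * s ^ 2) := hdψ (by simpa using hs)
      calc ‖ψ s‖ ^ N ≤ Real.exp (-(1 / 4) * s ^ 2) ^ N := by gcongr
        _ = Real.exp (-(N / 4) * s ^ 2) := by rw [← Real.exp_nat_mul]; congr 1; ring
        _ ≤ _ := le_add_of_nonneg_right (by positivity)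
    · have h3 : ‖ψ s‖ ^ N = ‖ψ s‖ ^ (N - k) * ‖ψ s‖ ^ k := by
        rw [← pow_add]; congr 1; omega
      have h4 : ‖ψ s‖ ^ k ≤ ‖ψ s‖ ^ ν := by
        rw [← Real.rpow_natCast]
        exact Real.rpow_le_rpow_of_exponent_ge' (norm_nonneg _) (norm_charFun_le_one s) hν
          (Nat.le_ceil ν)
      rw [h3]
      refine le_add_of_nonneg_of_le (Real.exp_pos _).le ?_
      exact mul_le_mul (pow_le_pow_left₀ (norm_nonneg _) (hη s hs) _) h4 (by positivity)
        (by positivity)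
  have hgi : Integrable fun s : ℝ => Real.exp (-(N / 4 : ℝ) * s ^ 2) :=
    integrable_exp_neg_mul_sq (by positivity)
  have hbi := hgi.add (hint.const_mul (η ^ (N - k)))
  have hi : Integrable (fun s : ℝ => ‖ψ s‖ ^ N) := by
    refine hbi.mono' (by fun_prop) (ae_of_all _ fun s => ?_)
    rw [Real.norm_of_nonneg (by positivity)]
    exact hpt s
  refine ⟨hi, (integral_mono hi hbi hpt).trans ?_⟩
  rw [integral_add' hgi (hint.const_mul _), integral_const_mul, integral_gaussian, add_div]
  have hsN : 0 < √(N : ℝ) := by positivity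
  refine add_le_add (le_of_eq ?_) ?_
  · rw [← Real.sqrt_div' _ (by positivity)]
    congr 1
    field_simp
  · rw [le_div_iff₀ hsN]
    have h5 : η ^ (N - k) * N ≤ D + k := by
      have h6 : ((N - k : ℕ) : ℝ) * η ^ (N - k) ≤ D := hD ⟨N - k, rfl⟩
      have h7 : (N : ℝ) = (N - k : ℕ) + k := by
        rw [← Nat.cast_add]; congr 1; omega
      have h8 : η ^ (N - k) ≤ 1 := pow_le_one₀ hη0 hη1.le
      have h9 : η ^ (N - k) * k ≤ 1 * k := by gcongr
      rw [h7, mul_add]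
      linarith
    have h10 : √(N : ℝ) ≤ N := Real.sqrt_le_iff.2 ⟨by positivity, by nlinarith⟩
    calc η ^ (N - k) * I * √N ≤ η ^ (N - k) * I * N := by gcongr
      _ = η ^ (N - k) * N * I := by ring
      _ ≤ (D + k) * I := by gcongr

/-- Arithmetic-geometric mean inequality in the form `∏ gᵢ ≤ N⁻¹ ∑ gᵢ ^ N` for `N` factors. -/
theorem prod_le_inv_card_mul_sum_pow {ι : Type*} {F : Finset ι} (hF : F.Nonempty) {g : ι → ℝ}
    (hg : ∀ i ∈ F, 0 ≤ g i) : ∏ i ∈ F, g i ≤ (F.card : ℝ)⁻¹ * ∑ i ∈ F, g i ^ F.card := by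
  have hc : (F.card : ℝ) ≠ 0 := by simpa using hF.ne_empty
  have h := Real.geom_mean_le_arith_mean_weighted F (fun _ => (F.card : ℝ)⁻¹)
    (fun i => g i ^ F.card) (fun _ _ => by positivity)
    (by rw [Finset.sum_const, nsmul_eq_mul, mul_inv_cancel₀ hc])
    (fun i hi => pow_nonneg (hg i hi) _)
  rw [← Finset.mul_sum] at h
  refine le_trans (le_of_eq (Finset.prod_congr rfl fun i hi => ?_)) h
  rw [Real.pow_rpow_inv_natCast (hg i hi) (by simpa using hF.ne_empty)]

/-- The integral of a product of dilates of `g` is controlled by that of a single power of `g`; the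
number of factors does not enter the constant. -/
theorem integral_prod_comp_mul_le {ι : Type*} {F : Finset ι} (hF : F.Nonempty) {a : ι → ℝ}
    {b : ℝ} (hb : 0 < b) (ha : ∀ i ∈ F, b ≤ |a i|) {g : ℝ → ℝ} (hg : Measurable g)
    (hg0 : ∀ s, 0 ≤ g s) (hint : Integrable fun s => g s ^ F.card) :
    Integrable (fun s => ∏ i ∈ F, g (a i * s)) ∧
      ∫ s, ∏ i ∈ F, g (a i * s) ≤ b⁻¹ * ∫ s, g s ^ F.card := by
  have ha0 : ∀ i ∈ F, a i ≠ 0 := fun i hi h => by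
    have := ha i hi
    rw [h, abs_zero] at this
    linarith
  have hi : ∀ i ∈ F, Integrable fun s => g (a i * s) ^ F.card := fun i hi =>
    hint.comp_mul_left' (ha0 i hi)
  have hsum : Integrable fun s => (F.card : ℝ)⁻¹ * ∑ i ∈ F, g (a i * s) ^ F.card :=
    (integrable_finsetSum F hi).const_mul _
  have hle : ∀ s, ∏ i ∈ F, g (a i * s) ≤ (F.card : ℝ)⁻¹ * ∑ i ∈ F, g (a i * s) ^ F.card :=
    fun s => prod_le_inv_card_mul_sum_pow hF fun i _ => hg0 _
  have hp : Integrable (fun s => ∏ i ∈ F, g (a i * s)) := by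
    refine hsum.mono' (Measurable.aestronglyMeasurable ?_) (ae_of_all _ fun s => ?_)
    · exact Finset.measurable_fun_prod _ fun i _ => hg.comp (measurable_const_mul _)
    · rw [Real.norm_of_nonneg (Finset.prod_nonneg fun i _ => hg0 _)]
      exact hle s
  refine ⟨hp, (integral_mono hp hsum hle).trans ?_⟩
  rw [integral_const_mul, integral_finsetSum F hi]
  have hone : ∀ i ∈ F, ∫ s, g (a i * s) ^ F.card ≤ b⁻¹ * ∫ s, g s ^ F.card := by
    intro i hi
    rw [Measure.integral_comp_mul_left (fun s => g s ^ F.card), smul_eq_mul, abs_inv]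
    refine mul_le_mul_of_nonneg_right ?_ (integral_nonneg fun s => pow_nonneg (hg0 s) _)
    exact inv_anti₀ hb (ha i hi)
  have hc : (F.card : ℝ) ≠ 0 := by simpa using hF.ne_empty
  calc (F.card : ℝ)⁻¹ * ∑ i ∈ F, ∫ s, g (a i * s) ^ F.card
      ≤ (F.card : ℝ)⁻¹ * ∑ i ∈ F, b⁻¹ * ∫ s, g s ^ F.card := by
        gcongr with i hi; exact hone i hi
    _ = b⁻¹ * ∫ s, g s ^ F.card := by
        rw [Finset.sum_const, nsmul_eq_mul, inv_mul_cancel_left₀ hc]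

/-- A linear combination of `N` of the innovations, with coefficients bounded away from zero, has a
density of order `N^{-1/2}`, uniformly in the coefficients. -/
theorem exists_map_sum_mul_le_smul_volume {Ω ι : Type*} [MeasurableSpace Ω] {μ : Measure Ω}
    [IsProbabilityMeasure μ] {ε : ι → Ω → ℝ} (hε : ∀ i, Measurable (ε i))
    (hindep : iIndepFun ε μ) (i₀ : ι) (hident : ∀ i, IdentDistrib (ε i) (ε i₀) μ μ)
    (h0 : ∫ ω, ε i₀ ω ∂μ = 0) (h1 : ∫ ω, (ε i₀ ^ 2) ω ∂μ = 1)
    (hac : μ.map (ε i₀) ≪ volume) {ν : ℝ} (hν : 0 ≤ ν)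
    (hint : Integrable fun s : ℝ => ‖charFun (μ.map (ε i₀)) s‖ ^ ν) {b : ℝ} (hb : 0 < b) :
    ∃ C : ℝ, 0 < C ∧ ∃ N₀ : ℕ, ∀ (F : Finset ι) (a : ι → ℝ), N₀ ≤ F.card →
      (∀ i ∈ F, b ≤ |a i|) →
      μ.map (fun ω => ∑ i ∈ F, a i * ε i ω) ≤ (C / √F.card).toNNReal • (volume : Measure ℝ) := by
  obtain ⟨C, hC, N₀, h⟩ := exists_integral_norm_charFun_pow_le (hε i₀).aemeasurable h0 h1 hac hν
    hint
  refine ⟨b⁻¹ * C, by positivity, N₀ + 1, fun F a hF ha => ?_⟩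
  have hFne : F.Nonempty := Finset.card_pos.1 (by omega)
  obtain ⟨hi, hle⟩ := h F.card (by omega)
  obtain ⟨hpi, hple⟩ := integral_prod_comp_mul_le hFne hb ha measurable_charFun.norm
    (fun _ => norm_nonneg _) hi
  have hm : ∀ i, Measurable fun ω => a i * ε i ω := fun i => (hε i).const_mul _
  have hchar : charFun (μ.map fun ω => ∑ i ∈ F, a i * ε i ω)
      = fun s => ∏ i ∈ F, charFun (μ.map (ε i₀)) (a i * s) := by
    have hind : iIndepFun (fun i ω => a i * ε i ω) μ :=
      hindep.comp (fun i y => a i * y) fun i => measurable_const_mul _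
    rw [iIndepFun.charFun_map_fun_finsetSum_eq_prod (fun i _ => (hm i).aemeasurable)
      (hind.restrict _)]
    funext s
    rw [Finset.prod_apply]
    refine Finset.prod_congr rfl fun i _ => ?_
    rw [charFun_map_mul_comp (hε i).aemeasurable, (hident i).map_eq]
  have hsm : Measurable fun ω => ∑ i ∈ F, a i * ε i ω := Finset.measurable_fun_sum _ fun i _ => hm i
  have : IsProbabilityMeasure (μ.map fun ω => ∑ i ∈ F, a i * ε i ω) :=
    Measure.isProbabilityMeasure_map hsm.aemeasurable
  have hnorm : (fun s => ‖charFun (μ.map fun ω => ∑ i ∈ F, a i * ε i ω) s‖)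
      = fun s => ∏ i ∈ F, ‖charFun (μ.map (ε i₀)) (a i * s)‖ := by
    funext s
    rw [hchar, norm_prod]
  have hci : Integrable (charFun (μ.map fun ω => ∑ i ∈ F, a i * ε i ω)) := by
    rw [← integrable_norm_iff measurable_charFun.aestronglyMeasurable, hnorm]
    exact hpi
  refine (measure_le_integral_norm_charFun_smul_volume hci).trans ?_
  refine Measure.le_iff.2 fun s _ => ?_
  simp only [Measure.smul_apply]
  refine mul_le_mul_left (ENNReal.coe_le_coe.2 (Real.toNNReal_le_toNNReal ?_)) _
  rw [hnorm, mul_div_assoc]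
  exact hple.trans (mul_le_mul_of_nonneg_left hle (by positivity))

/-! ### Partial sums of the linear process -/

theorem ProbabilityTheory.IndepFun.map_add_le_smul_volume {Ω : Type*} [MeasurableSpace Ω]
    {μ : Measure Ω} [IsProbabilityMeasure μ] {X Y : Ω → ℝ} (hX : Measurable X) (hY : Measurable Y)
    (hXY : IndepFun X Y μ) {K : ℝ≥0} (h : μ.map X ≤ K • (volume : Measure ℝ)) :
    μ.map (X + Y) ≤ K • (volume : Measure ℝ) := by
  have : IsProbabilityMeasure (μ.map X) := Measure.isProbabilityMeasure_map hX.aemeasurable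
  have : IsProbabilityMeasure (μ.map Y) := Measure.isProbabilityMeasure_map hY.aemeasurable
  refine Measure.le_iff.2 fun s hs => ?_
  rw [add_comm X Y, hXY.symm.map_add_eq_map_conv_map hY hX, Measure.conv,
    Measure.map_apply measurable_add hs, Measure.prod_apply (measurable_add hs)]
  calc ∫⁻ y, (μ.map X) (Prod.mk y ⁻¹' ((fun p : ℝ × ℝ => p.1 + p.2) ⁻¹' s)) ∂(μ.map Y)
      ≤ ∫⁻ _, K * volume s ∂(μ.map Y) := by
        refine lintegral_mono fun y => ((Measure.le_iff'.1 h) _).trans (le_of_eq ?_)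
        change (K : ℝ≥0∞) * volume ((fun x => y + x) ⁻¹' s) = _
        rw [measure_preimage_add]
    _ = K * volume s := by simp

theorem ProbabilityTheory.IndepFun.map_add_absolutelyContinuous {Ω : Type*} [MeasurableSpace Ω]
    {μ : Measure Ω} [IsProbabilityMeasure μ] {X Y : Ω → ℝ} (hX : Measurable X) (hY : Measurable Y)
    (hXY : IndepFun X Y μ) (h : μ.map X ≪ volume) : μ.map (X + Y) ≪ volume := by
  rw [add_comm X Y, hXY.symm.map_add_eq_map_conv_map hY hX]
  exact Measure.conv_absolutelyContinuous h

theorem integratedProcess_eq_add_sum {Ω : Type*} (x₀ : Ω → ℝ) (w : ℕ → Ω → ℝ) (t : ℕ) (ω : Ω) :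
    integratedProcess x₀ w t ω = x₀ ω + ∑ k ∈ Finset.Icc 1 t, w k ω := by
  induction t with
  | zero => simp [integratedProcess]
  | succ t ih =>
    simp only [integratedProcess]
    rw [ih, Finset.sum_Icc_succ_top (by omega)]
    ring

/-- The coefficient of `ε i` in `w_1 + ⋯ + w_t`, for the linear process `w` with
coefficients `φ`. -/
noncomputable def partialSumCoeff (φ : ℕ → ℝ) (t : ℕ) (i : ℤ) : ℝ :=
  ∑ k ∈ Finset.Icc 1 t, if i ≤ (k : ℤ) then φ ((k : ℤ) - i).toNat else 0

/-- Isolating finitely many innovations in `w_1 + ⋯ + w_t`: the rest is the same sum for the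
innovations with those of index in `F` replaced by zero. -/
theorem sum_linearProcess_eq {Ω : Type*} {φ : ℕ → ℝ} {ε : ℤ → Ω → ℝ} {ω : Ω}
    (hs : ∀ t : ℕ, Summable fun j : ℕ => |φ j * ε ((t : ℤ) - (j : ℤ)) ω|) (F : Finset ℤ) (t : ℕ) :
    ∑ k ∈ Finset.Icc 1 t, linearProcess φ ε k ω
      = ∑ i ∈ F, partialSumCoeff φ t i * ε i ω
        + ∑ k ∈ Finset.Icc 1 t, linearProcess φ (fun i ω => if i ∈ F then 0 else ε i ω) k ω := by
  have hsingle : ∀ (k : ℕ) (i : ℤ),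
      HasSum (fun j : ℕ => if (k : ℤ) - j = i then φ j * ε ((k : ℤ) - j) ω else 0)
        ((if i ≤ (k : ℤ) then φ ((k : ℤ) - i).toNat else 0) * ε i ω) := by
    intro k i
    by_cases hik : i ≤ (k : ℤ)
    · have h1 : ((k : ℤ) - (((k : ℤ) - i).toNat : ℤ)) = i := by
        rw [Int.toNat_of_nonneg (by omega)]; ring
      rw [if_pos hik]
      convert! hasSum_single (((k : ℤ) - i).toNat)
        (f := fun j : ℕ => if (k : ℤ) - j = i then φ j * ε ((k : ℤ) - j) ω else 0) ?_ using 1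
      · rw [if_pos h1, h1]
      · intro j hj
        rw [if_neg]
        intro h
        apply hj
        omega
    · rw [if_neg hik, zero_mul]
      convert! hasSum_zero with j
      rw [if_neg]
      omega
  have hk : ∀ k : ℕ, linearProcess φ ε k ω
      = ∑ i ∈ F, (if i ≤ (k : ℤ) then φ ((k : ℤ) - i).toNat else 0) * ε i ω
        + linearProcess φ (fun i ω => if i ∈ F then 0 else ε i ω) k ω := by
    intro k
    have h1 := hasSum_sum fun i (_ : i ∈ F) => hsingle k i
    have h2 : Summable fun j : ℕ => φ j * (if (k : ℤ) - j ∈ F then 0 else ε ((k : ℤ) - j) ω) := by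
      refine Summable.of_norm_bounded (hs k) fun j => ?_
      split_ifs
      · rw [mul_zero, norm_zero]
        exact abs_nonneg _
      · exact le_rfl
    have h3 := (h1.add h2.hasSum).tsum_eq
    rw [linearProcess, linearProcess, ← h3]
    refine tsum_congr fun j => ?_
    rw [Finset.sum_ite_eq]
    split_ifs <;> simp
  rw [Finset.sum_congr rfl fun k _ => hk k, Finset.sum_add_distrib, Finset.sum_comm]
  simp_rw [← Finset.sum_mul]
  rfl

theorem partialSumCoeff_sub {φ : ℕ → ℝ} {t m : ℕ} (hm : m < t) :
    partialSumCoeff φ t ((t : ℤ) - m) = ∑ j ∈ Finset.range (m + 1), φ j := by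
  rw [partialSumCoeff, ← Finset.sum_filter]
  refine Finset.sum_nbij' (fun k => k + m - t) (fun j => j + t - m) ?_ ?_ ?_ ?_ ?_
  · intro k hk; simp only [Finset.mem_filter, Finset.mem_Icc, Finset.mem_range] at *; omega
  · intro k hk; simp only [Finset.mem_filter, Finset.mem_Icc, Finset.mem_range] at *; omega
  · intro k hk; simp only [Finset.mem_filter, Finset.mem_Icc] at *; omega
  · intro k hk; simp only [Finset.mem_range] at *; omega
  · intro k hk
    simp only [Finset.mem_filter, Finset.mem_Icc] at hk
    congr 1
    omega

/-- No partial sum `w_1 + ⋯ + w_t` degenerates: summed over `i ≥ -M`, its coefficients tend to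
`t ∑ φ_j` as `M → ∞`. -/
theorem exists_partialSumCoeff_ne_zero {φ : ℕ → ℝ} (hφ : Summable φ) (hφ0 : ∑' j, φ j ≠ 0)
    {t : ℕ} (ht : 1 ≤ t) : ∃ i, partialSumCoeff φ t i ≠ 0 := by
  by_contra! h
  have hlim : Tendsto (fun M : ℕ => ∑ k ∈ Finset.Icc 1 t, ∑ j ∈ Finset.range (M + (k + 1)), φ j)
      atTop (𝓝 (∑ k ∈ Finset.Icc 1 t, ∑' j, φ j)) :=
    tendsto_finsetSum _ fun k _ => (tendsto_add_atTop_iff_nat (k + 1)).2 hφ.hasSum.tendsto_sum_nat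
  have hz : ∀ M : ℕ, ∑ k ∈ Finset.Icc 1 t, ∑ j ∈ Finset.range (M + (k + 1)), φ j = 0 := by
    intro M
    have h1 : ∑ i ∈ Finset.Icc (-(M : ℤ)) t, partialSumCoeff φ t i = 0 :=
      Finset.sum_eq_zero fun i _ => h i
    rw [← h1]
    simp_rw [partialSumCoeff]
    rw [Finset.sum_comm]
    refine Finset.sum_congr rfl fun k hk => ?_
    rw [← Finset.sum_filter]
    rw [Finset.mem_Icc] at hk
    refine Finset.sum_nbij' (fun j => (k : ℤ) - j) (fun i => ((k : ℤ) - i).toNat) ?_ ?_ ?_ ?_ ?_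
    · intro j hj; simp only [Finset.mem_filter, Finset.mem_Icc, Finset.mem_range] at *; omega
    · intro j hj; simp only [Finset.mem_filter, Finset.mem_Icc, Finset.mem_range] at *; omega
    · intro j hj; omega
    · intro j hj; simp only [Finset.mem_filter, Finset.mem_Icc] at *; omega
    · intro j hj
      congr 1
      omega
  simp_rw [hz] at hlim
  have h2 := tendsto_nhds_unique hlim tendsto_const_nhds
  rw [Finset.sum_const, nsmul_eq_mul] at h2
  simp only [Nat.card_Icc, mul_eq_zero, hφ0, or_false] at h2
  norm_cast at h2
  omega

/-- `measurable_linearProcess` with the σ-algebra as a named argument, so that it can be a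
sub-σ-algebra generated by some of the innovations. -/
theorem measurable_linearProcess_of_measurable {Ω : Type*} {m : MeasurableSpace Ω} (φ : ℕ → ℝ)
    {ε : ℤ → Ω → ℝ} (hε : ∀ i, Measurable (ε i)) (t : ℕ) : Measurable (linearProcess φ ε t) :=
  measurable_linearProcess φ hε t

section

variable {Ω : Type*} [MeasurableSpace Ω] {μ : Measure Ω}
  {ε : ℤ → Ω → ℝ} {φ : ℕ → ℝ}

/-- The two parts into which `sum_linearProcess_eq` splits the sum are functions of disjoint
families of innovations. -/
theorem indepFun_sum_mul_sum_linearProcess (hε : ∀ i, Measurable (ε i)) (hindep : iIndepFun ε μ)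
    (F : Finset ℤ) (c : ℤ → ℝ) (t : ℕ) :
    IndepFun (fun ω => ∑ i ∈ F, c i * ε i ω)
      (fun ω => ∑ k ∈ Finset.Icc 1 t,
        linearProcess φ (fun i ω => if i ∈ F then 0 else ε i ω) k ω) μ := by
  rw [IndepFun_iff_Indep]
  have h := indep_iSup_of_disjoint (fun i => (hε i).comap_le) hindep
    (S := (F : Set ℤ)) (T := (F : Set ℤ)ᶜ) disjoint_compl_right
  refine indep_of_indep_of_le_left (indep_of_indep_of_le_right h ?_) ?_
  · rw [← measurable_iff_comap_le]
    refine Finset.measurable_fun_sum _ fun k _ => ?_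
    refine measurable_linearProcess_of_measurable
      (m := ⨆ i ∈ (F : Set ℤ)ᶜ, MeasurableSpace.comap (ε i) _) φ (fun i => ?_) k
    by_cases hi : i ∈ F
    · simp only [hi, if_true]
      exact measurable_const
    · simp only [hi, if_false]
      exact (comap_measurable (ε i)).mono
        (le_iSup₂ (f := fun i (_ : i ∈ (F : Set ℤ)ᶜ) => MeasurableSpace.comap (ε i) _) i hi) le_rfl
  · rw [← measurable_iff_comap_le]
    refine Finset.measurable_fun_sum _ fun i hi => Measurable.const_mul ?_ _
    exact (comap_measurable (ε i)).mono
      (le_iSup₂ (f := fun i (_ : i ∈ (F : Set ℤ)) => MeasurableSpace.comap (ε i) _) i hi) le_rfl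

theorem map_sum_linearProcess_eq
    (hident : ∀ i, IdentDistrib (ε i) (ε 0) μ μ) (hint : Integrable (ε 0) μ)
    (hφ : Summable fun j => |φ j|) (F : Finset ℤ) (t : ℕ) :
    μ.map (fun ω => ∑ k ∈ Finset.Icc 1 t, linearProcess φ ε k ω)
      = μ.map ((fun ω => ∑ i ∈ F, partialSumCoeff φ t i * ε i ω)
        + fun ω => ∑ k ∈ Finset.Icc 1 t,
          linearProcess φ (fun i ω => if i ∈ F then 0 else ε i ω) k ω) := by
  refine Measure.map_congr ?_
  filter_upwards [ae_all_iff.2 (ae_summable_linearProcess hident hint hφ)] with ω hω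
  exact sum_linearProcess_eq hω F t

theorem measurable_sum_linearProcess_erase (hε : ∀ i, Measurable (ε i)) (F : Finset ℤ) (t : ℕ) :
    Measurable fun ω => ∑ k ∈ Finset.Icc 1 t,
      linearProcess φ (fun i ω => if i ∈ F then 0 else ε i ω) k ω := by
  refine Finset.measurable_fun_sum _ fun k _ => measurable_linearProcess φ (fun i => ?_) k
  split_ifs
  · exact measurable_const
  · exact hε i

/-- One innovation with nonzero coefficient already makes the law of `w_1 + ⋯ + w_t` absolutely
continuous, for every `t ≥ 1`. -/
theorem map_sum_linearProcess_absolutelyContinuous [IsProbabilityMeasure μ]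
    (hε : ∀ i, Measurable (ε i))
    (hindep : iIndepFun ε μ) (hident : ∀ i, IdentDistrib (ε i) (ε 0) μ μ)
    (hint : Integrable (ε 0) μ) (hac : μ.map (ε 0) ≪ volume) (hφ : Summable fun j => |φ j|)
    (hφ0 : ∑' j, φ j ≠ 0) {t : ℕ} (ht : 1 ≤ t) :
    μ.map (fun ω => ∑ k ∈ Finset.Icc 1 t, linearProcess φ ε k ω) ≪ volume := by
  obtain ⟨i, hi⟩ := exists_partialSumCoeff_ne_zero hφ.of_abs hφ0 ht
  rw [map_sum_linearProcess_eq hident hint hφ {i} t]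
  refine IndepFun.map_add_absolutelyContinuous
    (Finset.measurable_fun_sum _ fun i _ => (hε i).const_mul _)
    (measurable_sum_linearProcess_erase hε _ t)
    (indepFun_sum_mul_sum_linearProcess hε hindep _ _ t) ?_
  simp only [Finset.sum_singleton]
  have h1 : μ.map (fun ω => partialSumCoeff φ t i * ε i ω)
      = (μ.map (ε 0)).map (fun y => partialSumCoeff φ t i * y) := by
    rw [← (hident i).map_eq, Measure.map_map (measurable_const_mul _) (hε i)]
    rfl
  rw [h1]
  refine (hac.map (measurable_const_mul _)).trans ?_
  rw [Real.map_volume_mul_left hi]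
  exact Measure.smul_absolutelyContinuous

/-- The partial sums `w_1 + ⋯ + w_t` have, for large `t`, a density bounded by `K / √t`. -/
theorem exists_map_sum_linearProcess_le [IsProbabilityMeasure μ]
    (hε : ∀ i, Measurable (ε i))
    (hindep : iIndepFun ε μ) (hident : ∀ i, IdentDistrib (ε i) (ε 0) μ μ)
    (hint : Integrable (ε 0) μ) (h0 : ∫ ω, ε 0 ω ∂μ = 0) (h1 : ∫ ω, (ε 0 ^ 2) ω ∂μ = 1)
    (hac : μ.map (ε 0) ≪ volume) {ν : ℝ} (hν : 0 ≤ ν)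
    (hchar : Integrable fun s : ℝ => ‖charFun (μ.map (ε 0)) s‖ ^ ν)
    (hφ : Summable fun j => |φ j|) (hφ0 : ∑' j, φ j ≠ 0) :
    ∃ K : ℝ, 0 < K ∧ ∃ t₀ : ℕ, 1 ≤ t₀ ∧ ∀ t : ℕ, t₀ ≤ t →
      μ.map (fun ω => ∑ k ∈ Finset.Icc 1 t, linearProcess φ ε k ω)
        ≤ (K / √t).toNNReal • (volume : Measure ℝ) := by
  have hb : 0 < |∑' j, φ j| / 2 := by positivity
  obtain ⟨C, hC, N₀, h⟩ := exists_map_sum_mul_le_smul_volume hε hindep 0 hident h0 h1 hac hν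
    hchar hb
  have hlim := hφ.of_abs.hasSum.tendsto_sum_nat.abs
  obtain ⟨m₀, hm₀⟩ := eventually_atTop.1
    (hlim.eventually_const_le (show |∑' j, φ j| / 2 < |∑' j, φ j| by linarith))
  refine ⟨C * √2, by positivity, 2 * m₀ + 2 * N₀ + 1, by omega, fun t ht => ?_⟩
  -- the innovations whose coefficient is a partial sum of `φ` with at least `m₀` terms;
  -- they are at least `t / 2` in number
  set F : Finset ℤ := Finset.Icc 1 ((t : ℤ) - m₀)
  have hcard : F.card = t - m₀ := by
    simp only [F, Int.card_Icc]; omega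
  have hbound := h F (partialSumCoeff φ t) (by omega) (by
    intro i hi
    simp only [F, Finset.mem_Icc] at hi
    obtain ⟨m, rfl⟩ : ∃ m : ℕ, i = (t : ℤ) - m := ⟨((t : ℤ) - i).toNat, by omega⟩
    rw [partialSumCoeff_sub (by omega)]
    exact hm₀ (m + 1) (by omega))
  rw [map_sum_linearProcess_eq hident hint hφ F t]
  have hle := IndepFun.map_add_le_smul_volume
    (Finset.measurable_fun_sum _ fun i _ => (hε i).const_mul _)
    (measurable_sum_linearProcess_erase hε F t)
    (indepFun_sum_mul_sum_linearProcess (φ := φ) hε hindep F _ t) hbound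
  refine hle.trans (Measure.le_iff.2 fun s _ => ?_)
  simp only [Measure.smul_apply]
  refine mul_le_mul_left (ENNReal.coe_le_coe.2 (Real.toNNReal_le_toNNReal ?_)) _
  rw [hcard]
  have h3 : (t : ℝ) ≤ 2 * (t - m₀ : ℕ) := by exact_mod_cast (by omega : t ≤ 2 * (t - m₀))
  have ht0 : (0 : ℝ) < t := by exact_mod_cast (by omega : 0 < t)
  have h4 : √(t : ℝ) ≤ √2 * √((t - m₀ : ℕ) : ℝ) := by
    rw [← Real.sqrt_mul (by norm_num)]
    exact Real.sqrt_le_sqrt h3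
  have h5 : 0 < √((t - m₀ : ℕ) : ℝ) := Real.sqrt_pos.2 (by linarith)
  rw [div_le_div_iff₀ h5 (Real.sqrt_pos.2 ht0), mul_assoc]
  gcongr

/-- Cauchy-Schwarz for the partial sums of the series `∑ φ_j (ε_{1-j} + ⋯ + ε_{t-j})`, and Fatou's
lemma for its limit. -/
theorem lintegral_sq_sum_linearProcess_le [IsProbabilityMeasure μ]
    (hε : ∀ i, Measurable (ε i))
    (hindep : iIndepFun ε μ) (hident : ∀ i, IdentDistrib (ε i) (ε 0) μ μ)
    (hL2 : MemLp (ε 0) 2 μ) (h0 : ∫ ω, ε 0 ω ∂μ = 0) (hvar : Var[ε 0; μ] = 1)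
    (hφ : Summable fun j => |φ j|) (t : ℕ) :
    ∫⁻ ω, ENNReal.ofReal ((∑ k ∈ Finset.Icc 1 t, linearProcess φ ε k ω) ^ 2) ∂μ
      ≤ ENNReal.ofReal ((∑' j, |φ j|) ^ 2 * t) := by
  set Φ := ∑' j, |φ j|
  have hΦ : 0 ≤ Φ := tsum_nonneg fun j => abs_nonneg _
  set T : ℕ → Ω → ℝ := fun j ω => ∑ k ∈ Finset.Icc 1 t, ε ((k : ℤ) - (j : ℤ)) ω
  have hTm : ∀ j, Measurable (T j) := fun j => Finset.measurable_fun_sum _ fun k _ => hε _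
  have hmem : ∀ i, MemLp (ε i) 2 μ := fun i => (hident i).memLp_iff.2 hL2
  have hTL : ∀ j, MemLp (T j) 2 μ := fun j => memLp_finsetSum _ fun k _ => hmem _
  have hT2 : ∀ j, ∫ ω, T j ω ^ 2 ∂μ = t := by
    intro j
    have hT0 : ∫ ω, T j ω ∂μ = 0 := by
      rw [integral_finsetSum _ fun k _ => (hmem _).integrable (by norm_num)]
      exact Finset.sum_eq_zero fun k _ => by rw [(hident _).integral_eq, h0]
    rw [← variance_of_integral_eq_zero (hTm j).aemeasurable hT0]
    have hTe : T j = ∑ k ∈ Finset.Icc 1 t, ε ((k : ℤ) - (j : ℤ)) := by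
      funext ω; simp [T]
    rw [hTe, IndepFun.variance_sum (fun k _ => hmem _)]
    · rw [Finset.sum_congr rfl fun k _ => (hident _).variance_eq.trans hvar]
      simp
    · intro k _ l _ hkl
      exact hindep.indepFun (by simpa using hkl)
  set P : ℕ → Ω → ℝ := fun J ω => ∑ j ∈ Finset.range J, φ j * T j ω
  have hPm : ∀ J, Measurable (P J) := fun J =>
    Finset.measurable_fun_sum _ fun j _ => (hTm j).const_mul _
  have hPbound : ∀ J, ∫⁻ ω, ENNReal.ofReal (P J ω ^ 2) ∂μ ≤ ENNReal.ofReal (Φ ^ 2 * t) := by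
    intro J
    have hi : Integrable (fun ω => Φ * ∑ j ∈ Finset.range J, |φ j| * T j ω ^ 2) μ :=
      (integrable_finsetSum _ fun j _ => (hTL j).integrable_sq.const_mul _).const_mul _
    have hpt : ∀ ω, P J ω ^ 2 ≤ Φ * ∑ j ∈ Finset.range J, |φ j| * T j ω ^ 2 := by
      intro ω
      refine (Finset.sum_sq_le_sum_mul_sum_of_sq_le_mul _ (f := fun j => |φ j|)
        (g := fun j => |φ j| * T j ω ^ 2) (fun j _ => abs_nonneg _) (fun j _ => by positivity)
        fun j _ => ?_).trans ?_
      · rw [← mul_assoc, mul_pow, abs_mul_abs_self, sq (φ j)]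
      · exact mul_le_mul_of_nonneg_right (hφ.sum_le_tsum _ fun j _ => abs_nonneg _)
          (Finset.sum_nonneg fun j _ => by positivity)
    refine (lintegral_mono fun ω => ENNReal.ofReal_le_ofReal (hpt ω)).trans ?_
    rw [← ofReal_integral_eq_lintegral_ofReal hi (ae_of_all _ fun ω => (sq_nonneg _).trans (hpt ω))]
    refine ENNReal.ofReal_le_ofReal ?_
    rw [integral_const_mul, integral_finsetSum _ fun j _ => (hTL j).integrable_sq.const_mul _]
    simp_rw [integral_const_mul, hT2]
    rw [← Finset.sum_mul, sq, mul_assoc]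
    gcongr
    exact hφ.sum_le_tsum _ fun j _ => abs_nonneg _
  have hlim : ∀ᵐ ω ∂μ, Tendsto (fun J => ENNReal.ofReal (P J ω ^ 2)) atTop
      (𝓝 (ENNReal.ofReal ((∑ k ∈ Finset.Icc 1 t, linearProcess φ ε k ω) ^ 2))) := by
    filter_upwards [ae_all_iff.2 (ae_summable_linearProcess hident
      (hL2.integrable (by norm_num)) hφ)] with ω hω
    refine ENNReal.tendsto_ofReal (Tendsto.pow ?_ 2)
    have h := (hasSum_sum fun k (_ : k ∈ Finset.Icc 1 t) =>
      (hω k).of_abs.hasSum).tendsto_sum_nat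
    refine h.congr fun J => Finset.sum_congr rfl fun j _ => ?_
    rw [Finset.mul_sum]
  calc ∫⁻ ω, ENNReal.ofReal ((∑ k ∈ Finset.Icc 1 t, linearProcess φ ε k ω) ^ 2) ∂μ
      = ∫⁻ ω, liminf (fun J => ENNReal.ofReal (P J ω ^ 2)) atTop ∂μ := by
        refine lintegral_congr_ae ?_
        filter_upwards [hlim] with ω hω using hω.liminf_eq.symm
    _ ≤ liminf (fun J => ∫⁻ ω, ENNReal.ofReal (P J ω ^ 2) ∂μ) atTop :=
        lintegral_liminf_le fun J => ((hPm J).pow_const 2).ennreal_ofReal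
    _ ≤ ENNReal.ofReal (Φ ^ 2 * t) := by
        refine liminf_le_of_frequently_le' (Frequently.of_forall hPbound)

end

/-! ### Boundedness in probability and the rates -/

section

variable {Ω : Type*} [MeasurableSpace Ω] {μ : Measure Ω}

/-- Markov's inequality after truncation: it suffices to bound `|Y n|`, on an event of probability
at least `1 - δ`, by a function whose expectation is `O(d n)` with a constant depending on `δ`. -/
theorem isBigOInProbability_of_lintegral_le {Y : ℕ → Ω → ℝ} {d : ℕ → ℝ}
    (hd : ∀ᶠ n in atTop, 0 < d n)
    (h : ∀ δ : ℝ, 0 < δ → ∃ C : ℝ, 0 < C ∧ ∀ᶠ n in atTop, ∃ (G : Set Ω) (f : Ω → ℝ≥0∞),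
      μ Gᶜ ≤ ENNReal.ofReal δ ∧ Measurable f ∧ (∀ ω ∈ G, ENNReal.ofReal |Y n ω| ≤ f ω) ∧
        ∫⁻ ω, f ω ∂μ ≤ ENNReal.ofReal (C * d n)) :
    IsBigOInProbability μ Y d := by
  intro δ hδ
  obtain ⟨C, hC, hn⟩ := h (δ / 4) (by positivity)
  obtain ⟨N, hN⟩ := eventually_atTop.1 (hn.and hd)
  refine ⟨4 * C / δ, by positivity, N, fun n hNn => ?_⟩
  obtain ⟨⟨G, f, hG, hf, hYf, hfC⟩, hdn⟩ := hN n hNn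
  have hM : 0 < 4 * C / δ * d n := by positivity
  have hsub : {ω | 4 * C / δ * |d n| < |Y n ω|}
      ⊆ Gᶜ ∪ {ω | ENNReal.ofReal (4 * C / δ * d n) ≤ f ω} := by
    intro ω hω
    by_cases hωG : ω ∈ G
    · refine Or.inr (le_trans (ENNReal.ofReal_le_ofReal ?_) (hYf ω hωG))
      rw [Set.mem_ofPred_eq, abs_of_pos hdn] at hω
      exact hω.le
    · exact Or.inl hωG
  have hmark : μ {ω | ENNReal.ofReal (4 * C / δ * d n) ≤ f ω} ≤ ENNReal.ofReal (δ / 4) := by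
    refine (meas_ge_le_lintegral_div hf.aemeasurable (by simpa using hM)
      ENNReal.ofReal_ne_top).trans ?_
    refine (ENNReal.div_le_div_right hfC _).trans ?_
    rw [← ENNReal.ofReal_div_of_pos hM]
    refine ENNReal.ofReal_le_ofReal (le_of_eq ?_)
    field_simp
  calc μ {ω | 4 * C / δ * |d n| < |Y n ω|}
      ≤ μ Gᶜ + μ {ω | ENNReal.ofReal (4 * C / δ * d n) ≤ f ω} :=
        (measure_mono hsub).trans (measure_union_le _ _)
    _ ≤ ENNReal.ofReal (δ / 4) + ENNReal.ofReal (δ / 4) := add_le_add hG hmark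
    _ = ENNReal.ofReal (δ / 2) := by
        rw [← ENNReal.ofReal_add (by positivity) (by positivity)]; congr 1; ring
    _ < ENNReal.ofReal δ := (ENNReal.ofReal_lt_ofReal_iff hδ).2 (by linarith)

theorem IsBigOInProbability.mono {Y Z : ℕ → Ω → ℝ} {d : ℕ → ℝ}
    (hZ : IsBigOInProbability μ Z d) (h : ∀ n ω, |Y n ω| ≤ |Z n ω|) :
    IsBigOInProbability μ Y d := by
  intro δ hδ
  obtain ⟨M, hM, N, hN⟩ := hZ δ hδ
  exact ⟨M, hM, N, fun n hn => (measure_mono fun ω hω => lt_of_lt_of_le hω (h n ω)).trans_lt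
    (hN n hn)⟩

theorem exists_measure_lt_abs_le [IsFiniteMeasure μ] {X : Ω → ℝ} (hX : Measurable X) {δ : ℝ}
    (hδ : 0 < δ) : ∃ M : ℝ, 0 < M ∧ μ {ω | M < |X ω|} ≤ ENNReal.ofReal δ := by
  have h := tendsto_measure_iInter_atTop (μ := μ) (s := fun n : ℕ => {ω | (n : ℝ) < |X ω|})
    (fun n => (measurableSet_lt measurable_const hX.abs).nullMeasurableSet)
    (fun m n hmn ω (hω : (n : ℝ) < |X ω|) =>
      lt_of_le_of_lt (show (m : ℝ) ≤ n by exact_mod_cast hmn) hω)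
    ⟨0, measure_ne_top _ _⟩
  have he : ⋂ n : ℕ, {ω | (n : ℝ) < |X ω|} = ∅ := by
    refine Set.eq_empty_of_forall_notMem fun ω hω => ?_
    obtain ⟨n, hn⟩ := exists_nat_gt |X ω|
    exact lt_asymm hn (Set.mem_iInter.1 hω n)
  rw [he, measure_empty] at h
  obtain ⟨n, hn, hn0⟩ := ((h.eventually (ge_mem_nhds (ENNReal.ofReal_pos.2 hδ))).and
    (eventually_gt_atTop 0)).exists
  exact ⟨n, by exact_mod_cast hn0, hn⟩

/-- If `E(|V| ∣ X)` is constant, then `|V|` and functions of `X` multiply under expectation. -/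
theorem lintegral_abs_mul_comp_of_condExp_eq [IsFiniteMeasure μ] {V X : Ω → ℝ}
    (hV : Measurable V) (hVi : Integrable V μ) (hX : Measurable X)
    (h : μ[fun ω => |V ω| | MeasurableSpace.comap X inferInstance] =ᵐ[μ] fun _ => ∫ ω, |V ω| ∂μ)
    {f : ℝ → ℝ≥0∞} (hf : Measurable f) :
    ∫⁻ ω, ENNReal.ofReal |V ω| * f (X ω) ∂μ
      = ENNReal.ofReal (∫ ω, |V ω| ∂μ) * ∫⁻ ω, f (X ω) ∂μ := by
  have hVm : Measurable fun ω => ENNReal.ofReal |V ω| := hV.abs.ennreal_ofReal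
  have hmeas : (μ.withDensity fun ω => ENNReal.ofReal |V ω|).map X
      = ENNReal.ofReal (∫ ω, |V ω| ∂μ) • μ.map X := by
    ext s hs
    have hXs := hX hs
    rw [Measure.map_apply hX hs, withDensity_apply _ hXs, Measure.smul_apply,
      Measure.map_apply hX hs, smul_eq_mul,
      ← ofReal_integral_eq_lintegral_ofReal hVi.abs.integrableOn
        (ae_of_all _ fun _ => abs_nonneg _),
      ← setIntegral_condExp hX.comap_le hVi.abs ⟨s, hs, rfl⟩,
      setIntegral_congr_ae hXs (h.mono fun ω hω _ => hω), setIntegral_const, smul_eq_mul,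
      ENNReal.ofReal_mul measureReal_nonneg, Measure.real,
      ENNReal.ofReal_toReal (measure_ne_top _ _), mul_comm]
  rw [← lintegral_map hf hX, ← smul_eq_mul, ← lintegral_smul_measure, ← hmeas, lintegral_map hf hX]
  exact (lintegral_withDensity_eq_lintegral_mul _ hVm (hf.comp hX)).symm

end

theorem sum_inv_sqrt_le (n : ℕ) : ∑ t ∈ Finset.Icc 1 n, (√(t : ℝ))⁻¹ ≤ 2 * √(n : ℝ) := by
  induction n with
  | zero => simp
  | succ n ih =>
    rw [Finset.sum_Icc_succ_top (by omega)]
    have h1 : 0 < √((n + 1 : ℕ) : ℝ) := Real.sqrt_pos.2 (by positivity)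
    have h2 : √(n : ℝ) ^ 2 = n := Real.sq_sqrt (by positivity)
    have h3 : √((n + 1 : ℕ) : ℝ) ^ 2 = n + 1 := by
      rw [Real.sq_sqrt (by positivity)]; push_cast; ring
    have h4 : (√((n + 1 : ℕ) : ℝ))⁻¹ ≤ 2 * (√((n + 1 : ℕ) : ℝ) - √(n : ℝ)) := by
      rw [inv_le_iff_one_le_mul₀ h1]
      nlinarith [sq_nonneg (√((n + 1 : ℕ) : ℝ) - √(n : ℝ))]
    linarith

theorem lintegral_abs_rpow_annulus_le {κ R : ℝ} (hκ : 0 < κ) (hκR : κ ≤ R) (α : ℝ) :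
    ∫⁻ y in {y : ℝ | κ < |y| ∧ |y| ≤ R}, ENNReal.ofReal (|y| ^ (-α))
      ≤ ENNReal.ofReal (2 * ∫ y in κ..R, y ^ (-α)) := by
  have hIoc : ∫⁻ y in Set.Ioc κ R, ENNReal.ofReal (|y| ^ (-α))
      = ENNReal.ofReal (∫ y in κ..R, y ^ (-α)) := by
    have hi : IntegrableOn (fun y : ℝ => y ^ (-α)) (Set.Ioc κ R) := by
      refine (ContinuousOn.integrableOn_Icc (fun y hy => ?_)).mono_set Set.Ioc_subset_Icc_self
      exact (Real.continuousAt_rpow_const y _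
        (Or.inl (hκ.trans_le hy.1).ne')).continuousWithinAt
    rw [intervalIntegral.integral_of_le hκR, ofReal_integral_eq_lintegral_ofReal hi]
    · refine setLIntegral_congr_fun measurableSet_Ioc fun y hy => ?_
      simp only [abs_of_pos (hκ.trans hy.1)]
    · filter_upwards [ae_restrict_mem measurableSet_Ioc] with y hy
      exact Real.rpow_nonneg (hκ.trans hy.1).le _
  have hsub : {y : ℝ | κ < |y| ∧ |y| ≤ R} ⊆ Set.Ioc κ R ∪ Neg.neg ⁻¹' Set.Ioc κ R := by
    rintro y ⟨h1, h2⟩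
    rcases abs_cases y with ⟨h, _⟩ | ⟨h, _⟩
    · left; rw [h] at h1 h2; exact ⟨h1, h2⟩
    · right; rw [h] at h1 h2; exact ⟨h1, h2⟩
  have hneg : ∫⁻ y in Neg.neg ⁻¹' Set.Ioc κ R, ENNReal.ofReal (|y| ^ (-α))
      = ∫⁻ y in Set.Ioc κ R, ENNReal.ofReal (|y| ^ (-α)) := by
    rw [← (Measure.measurePreserving_neg (volume : Measure ℝ)).setLIntegral_comp_preimage
      measurableSet_Ioc (by fun_prop)]
    simp only [abs_neg]
  have hnn : 0 ≤ ∫ y in κ..R, y ^ (-α) :=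
    intervalIntegral.integral_nonneg hκR fun y hy => Real.rpow_nonneg (hκ.le.trans hy.1) _
  refine (lintegral_mono_set hsub).trans ((lintegral_union_le _ _ _).trans ?_)
  rw [hneg, hIoc, ← ENNReal.ofReal_add hnn hnn, two_mul]

/-- The two quantities that arise for `α ≥ 0` are of the order of the rate: `n · n^{-α/2}` from the
values `|x_t| > √n`, and `√n ∫ |y|^{-α}` over `e / √n < |y| ≤ √n` from the others. -/
theorem exists_powerSumRate_bounds {α : ℝ} {e : ℝ} (he : 0 < e) (he1 : e ≤ 1) :
    ∃ C : ℝ, 0 < C ∧ ∀ n : ℕ, 3 ≤ n →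
      (n : ℝ) * √(n : ℝ) ^ (-α) ≤ powerSumRate α n ∧
      √(n : ℝ) * (2 * ∫ y in (e / √(n : ℝ))..√(n : ℝ), y ^ (-α)) ≤ C * powerSumRate α n := by
  have hloge : Real.log e ≤ 0 := Real.log_nonpos he.le he1
  have hpos : ∀ n : ℕ, 3 ≤ n → (0 : ℝ) < n ∧ (1 : ℝ) ≤ n := fun n hn =>
    ⟨by exact_mod_cast (by omega : 0 < n), by exact_mod_cast (by omega : 1 ≤ n)⟩
  have hrate : ∀ n : ℕ, 3 ≤ n → (n : ℝ) * √(n : ℝ) ^ (-α) = (n : ℝ) ^ (1 - α / 2) := by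
    intro n hn
    obtain ⟨h0, -⟩ := hpos n hn
    rw [Real.sqrt_eq_rpow, ← Real.rpow_mul h0.le]
    nth_rewrite 1 [← Real.rpow_one (n : ℝ)]
    rw [← Real.rpow_add h0]
    congr 1; ring
  have hint : α ≠ 1 → ∀ n : ℕ, 3 ≤ n → ∫ y in (e / √(n : ℝ))..√(n : ℝ), y ^ (-α)
      = (√(n : ℝ) ^ (1 - α) - (e / √(n : ℝ)) ^ (1 - α)) / (1 - α) := by
    intro hα n hn
    obtain ⟨h0, -⟩ := hpos n hn
    have hs : 0 < √(n : ℝ) := Real.sqrt_pos.2 h0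
    rw [integral_rpow]
    · rw [neg_add_eq_sub]
    · refine Or.inr ⟨fun h => hα (by linarith), ?_⟩
      exact Set.notMem_uIcc_of_lt (by positivity) hs
  rcases lt_trichotomy α 1 with hα | hα | hα
  · refine ⟨2 / (1 - α), div_pos two_pos (by linarith), fun n hn => ?_⟩
    obtain ⟨h0, h1⟩ := hpos n hn
    have hs : 0 < √(n : ℝ) := Real.sqrt_pos.2 h0
    have hr : powerSumRate α n = (n : ℝ) ^ (1 - α / 2) := by
      rw [powerSumRate, if_neg (by linarith), if_neg hα.ne]
    refine ⟨by rw [hrate n hn, hr], ?_⟩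
    rw [hint hα.ne n hn, hr, ← hrate n hn]
    have h2 : (n : ℝ) * √(n : ℝ) ^ (-α) = √(n : ℝ) * √(n : ℝ) ^ (1 - α) := by
      rw [sub_eq_add_neg, Real.rpow_add hs, Real.rpow_one, ← mul_assoc, Real.mul_self_sqrt h0.le]
    rw [h2]
    have h3 : 0 ≤ (e / √(n : ℝ)) ^ (1 - α) := by positivity
    have h4 : (√(n : ℝ) ^ (1 - α) - (e / √(n : ℝ)) ^ (1 - α)) / (1 - α)
        ≤ √(n : ℝ) ^ (1 - α) / (1 - α) :=
      div_le_div_of_nonneg_right (by linarith) (by linarith)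
    calc _ ≤ √(n : ℝ) * (2 * (√(n : ℝ) ^ (1 - α) / (1 - α))) := by gcongr
      _ = _ := by ring
  · refine ⟨2 * (1 - Real.log e), by linarith, fun n hn => ?_⟩
    obtain ⟨h0, h1⟩ := hpos n hn
    have hs : 0 < √(n : ℝ) := Real.sqrt_pos.2 h0
    have hlog : 1 ≤ Real.log n := by
      rw [Real.le_log_iff_exp_le h0]
      have : (3 : ℝ) ≤ n := by exact_mod_cast hn
      linarith [Real.exp_one_lt_three]
    have hr : powerSumRate α n = √(n : ℝ) * Real.log n := by
      rw [powerSumRate, if_neg (by linarith), if_pos hα, Real.sqrt_eq_rpow]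
    rw [hrate n hn, hr, hα]
    constructor
    · rw [show (1 : ℝ) - 1 / 2 = 1 / 2 by norm_num, ← Real.sqrt_eq_rpow]
      nlinarith
    · have h2 : ∫ y in (e / √(n : ℝ))..√(n : ℝ), y ^ (-1 : ℝ) = Real.log n - Real.log e := by
        simp_rw [Real.rpow_neg_one]
        rw [integral_inv_of_pos (by positivity) hs, ← Real.log_div h0.ne' he.ne']
        congr 1
        rw [div_div_eq_mul_div, Real.mul_self_sqrt h0.le]
      rw [h2]
      have h3 : Real.log n - Real.log e ≤ (1 - Real.log e) * Real.log n := by nlinarith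
      calc _ ≤ √(n : ℝ) * (2 * ((1 - Real.log e) * Real.log n)) := by gcongr
        _ = _ := by ring
  · refine ⟨2 * e ^ (1 - α) / (α - 1), div_pos (by positivity) (by linarith), fun n hn => ?_⟩
    obtain ⟨h0, h1⟩ := hpos n hn
    have hs : 0 < √(n : ℝ) := Real.sqrt_pos.2 h0
    have hr : powerSumRate α n = (n : ℝ) ^ (α / 2) := by rw [powerSumRate, if_pos hα]
    rw [hrate n hn, hr]
    refine ⟨Real.rpow_le_rpow_of_exponent_le h1 (by linarith), ?_⟩
    rw [hint hα.ne' n hn]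
    have h2 : (n : ℝ) ^ (α / 2) = √(n : ℝ) * (√(n : ℝ) ^ (1 - α))⁻¹ := by
      rw [← Real.rpow_neg hs.le, ← Real.rpow_one_add' hs.le (by linarith),
        Real.sqrt_eq_rpow, ← Real.rpow_mul h0.le]
      congr 1; ring
    have h3 : 0 ≤ √(n : ℝ) ^ (1 - α) := by positivity
    have h4 : (√(n : ℝ) ^ (1 - α) - (e / √(n : ℝ)) ^ (1 - α)) / (1 - α)
        ≤ (e / √(n : ℝ)) ^ (1 - α) / (α - 1) := by
      rw [← neg_div_neg_eq, neg_sub, neg_sub]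
      exact div_le_div_of_nonneg_right (by linarith) (by linarith)
    calc _ ≤ √(n : ℝ) * (2 * ((e / √(n : ℝ)) ^ (1 - α) / (α - 1))) := by gcongr
      _ = _ := by rw [Real.div_rpow he.le hs.le, h2]; ring

theorem eventually_one_le_powerSumRate (α : ℝ) : ∀ᶠ n : ℕ in atTop, 1 ≤ powerSumRate α n := by
  filter_upwards [eventually_ge_atTop 3] with n hn
  have h1 : (1 : ℝ) ≤ n := by exact_mod_cast (by omega : 1 ≤ n)
  have hlog : 1 ≤ Real.log n := by
    rw [Real.le_log_iff_exp_le (by linarith)]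
    have : (3 : ℝ) ≤ n := by exact_mod_cast hn
    linarith [Real.exp_one_lt_three]
  rw [powerSumRate]
  split_ifs with h2 h3
  · exact Real.one_le_rpow h1 (by linarith)
  · exact one_le_mul_of_one_le_of_one_le (Real.one_le_rpow h1 (by norm_num)) hlog
  · exact Real.one_le_rpow h1 (by linarith)

/-! ### Sums of weighted powers -/

/-- On `κ < |y| ≤ R` the law is compared with Lebesgue measure; beyond `R` the integrand is at most
`R ^ (-α)`. -/
theorem lintegral_truncated_rpow_le {ρ : Measure ℝ} [IsProbabilityMeasure ρ] {L : ℝ}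
    (hL : 0 ≤ L) (hρ : ρ ≤ L.toNNReal • (volume : Measure ℝ)) {κ R α : ℝ} (hκ : 0 < κ)
    (hκR : κ ≤ R) (hα : 0 ≤ α) :
    ∫⁻ y, {y : ℝ | κ < |y|}.indicator (fun y => ENNReal.ofReal (|y| ^ (-α))) y ∂ρ
      ≤ ENNReal.ofReal (L * (2 * ∫ y in κ..R, y ^ (-α)) + R ^ (-α)) := by
  have hR : 0 < R := hκ.trans_le hκR
  have hms : MeasurableSet {y : ℝ | κ < |y| ∧ |y| ≤ R} :=
    (measurableSet_lt measurable_const measurable_id.abs).inter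
      (measurableSet_le measurable_id.abs measurable_const)
  have hnn : 0 ≤ ∫ y in κ..R, y ^ (-α) :=
    intervalIntegral.integral_nonneg hκR fun y hy => Real.rpow_nonneg (hκ.le.trans hy.1) _
  calc ∫⁻ y, {y : ℝ | κ < |y|}.indicator (fun y => ENNReal.ofReal (|y| ^ (-α))) y ∂ρ
      ≤ ∫⁻ y, ({y : ℝ | κ < |y| ∧ |y| ≤ R}.indicator
          (fun y => ENNReal.ofReal (|y| ^ (-α))) y + ENNReal.ofReal (R ^ (-α))) ∂ρ := by
        refine lintegral_mono fun y => ?_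
        by_cases h1 : κ < |y|
        · by_cases h2 : |y| ≤ R
          · rw [Set.indicator_of_mem (show y ∈ {y : ℝ | κ < |y|} from h1),
              Set.indicator_of_mem (show y ∈ {y : ℝ | κ < |y| ∧ |y| ≤ R} from ⟨h1, h2⟩)]
            exact le_self_add
          · refine le_add_left ?_
            rw [Set.indicator_of_mem (show y ∈ {y : ℝ | κ < |y|} from h1)]
            exact ENNReal.ofReal_le_ofReal
              (Real.rpow_le_rpow_of_nonpos hR (not_le.1 h2).le (by linarith))
        · rw [Set.indicator_of_notMem (show y ∉ {y : ℝ | κ < |y|} from h1)]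
          exact zero_le
    _ = ∫⁻ y in {y : ℝ | κ < |y| ∧ |y| ≤ R}, ENNReal.ofReal (|y| ^ (-α)) ∂ρ
          + ENNReal.ofReal (R ^ (-α)) := by
        rw [lintegral_add_right _ measurable_const, lintegral_indicator hms]
        simp
    _ ≤ L.toNNReal * ENNReal.ofReal (2 * ∫ y in κ..R, y ^ (-α))
          + ENNReal.ofReal (R ^ (-α)) := by
        refine add_le_add_left ?_ _
        refine (lintegral_mono' (Measure.restrict_mono le_rfl hρ) le_rfl).trans ?_
        rw [Measure.restrict_smul, lintegral_smul_measure]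
        exact mul_le_mul_right (lintegral_abs_rpow_annulus_le hκ hκR α) _
    _ = _ := by
        rw [ENNReal.ofReal_add (by positivity) (by positivity), ENNReal.ofReal_mul hL]
        rfl

section

variable {Ω : Type*} [MeasurableSpace Ω] {μ : Measure Ω}

/-- Up to time `n`, the process stays at distance `e / √n` from zero except with probability `O(e)`:
a union bound with `∑ t^{-1/2} ≤ 2 √n`. -/
theorem measure_exists_abs_le_le {x : ℕ → Ω → ℝ} (hx : ∀ t, Measurable (x t)) {K : ℝ}
    (hK : 0 < K) {t₀ : ℕ} (ht₀ : 1 ≤ t₀)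
    (hlaw : ∀ t, t₀ ≤ t → μ.map (x t) ≤ (K / √t).toNNReal • (volume : Measure ℝ)) {e : ℝ}
    (he : 0 < e) (n : ℕ) :
    μ {ω | ∃ t ∈ Finset.Icc t₀ n, |x t ω| ≤ e / √(n : ℝ)} ≤ ENNReal.ofReal (4 * K * e) := by
  have hset : {ω | ∃ t ∈ Finset.Icc t₀ n, |x t ω| ≤ e / √(n : ℝ)}
      = ⋃ t ∈ Finset.Icc t₀ n, x t ⁻¹' Metric.closedBall 0 (e / √(n : ℝ)) := by
    ext ω; simp
  have hone : ∀ t ∈ Finset.Icc t₀ n, μ (x t ⁻¹' Metric.closedBall 0 (e / √(n : ℝ)))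
      ≤ ENNReal.ofReal (K / √t * (2 * (e / √(n : ℝ)))) := by
    intro t ht
    rw [← Measure.map_apply (hx t) Metric.isClosed_closedBall.measurableSet]
    refine ((Measure.le_iff'.1 (hlaw t (Finset.mem_Icc.1 ht).1)) _).trans (le_of_eq ?_)
    rw [ENNReal.ofReal_mul (by positivity), Measure.smul_apply, Real.volume_closedBall]
    rfl
  rw [hset]
  refine (measure_biUnion_finset_le _ _).trans ((Finset.sum_le_sum hone).trans ?_)
  rw [← ENNReal.ofReal_sum_of_nonneg fun t _ => by positivity]
  refine ENNReal.ofReal_le_ofReal ?_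
  rcases Nat.eq_zero_or_pos n with rfl | hn
  · rw [Finset.Icc_eq_empty (by omega), Finset.sum_empty]; positivity
  have hs : 0 < √(n : ℝ) := Real.sqrt_pos.2 (by exact_mod_cast hn)
  have hsum : ∑ t ∈ Finset.Icc t₀ n, (√(t : ℝ))⁻¹ ≤ 2 * √(n : ℝ) :=
    (Finset.sum_le_sum_of_subset_of_nonneg (Finset.Icc_subset_Icc_left ht₀)
      fun _ _ _ => by positivity).trans (sum_inv_sqrt_le n)
  calc ∑ t ∈ Finset.Icc t₀ n, K / √t * (2 * (e / √(n : ℝ)))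
      = K * (2 * (e / √(n : ℝ))) * ∑ t ∈ Finset.Icc t₀ n, (√(t : ℝ))⁻¹ := by
        rw [Finset.mul_sum]
        exact Finset.sum_congr rfl fun t _ => by ring
    _ ≤ K * (2 * (e / √(n : ℝ))) * (2 * √(n : ℝ)) := by gcongr
    _ = 4 * K * e := by field_simp; ring

/-- The rates for `α ≥ 0`: only the density bound on the laws of `x t` for large `t` is used, so the
first few terms may have infinite expectation. -/
theorem isBigOInProbability_sum_of_nonneg [IsProbabilityMeasure μ]
    {x v : ℕ → Ω → ℝ} (hx : ∀ t, Measurable (x t))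
    {K : ℝ} (hK : 0 < K) {t₀ : ℕ} (ht₀ : 1 ≤ t₀)
    (hlaw : ∀ t, t₀ ≤ t → μ.map (x t) ≤ (K / √t).toNNReal • (volume : Measure ℝ))
    {α : ℝ} (hα : 0 ≤ α) (hv : ∀ t, 1 ≤ t → Measurable (v t))
    (hvi : ∀ t, 1 ≤ t → Integrable (v t) μ) {C : ℝ}
    (hvC : ∀ t, 1 ≤ t → ∫ ω, |v t ω| ∂μ ≤ C)
    (hcond : ∀ t, 1 ≤ t →
      μ[fun ω => |v t ω| | MeasurableSpace.comap (x t) inferInstance]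
        =ᵐ[μ] fun _ => ∫ ω, |v t ω| ∂μ) :
    IsBigOInProbability μ (fun n ω => ∑ t ∈ Finset.Icc 1 n, |v t ω| * |x t ω| ^ (-α))
      (powerSumRate α) := by
  have hC : 0 ≤ C := (integral_nonneg fun ω => abs_nonneg _).trans (hvC 1 le_rfl)
  have hterm : ∀ t ω, 0 ≤ |v t ω| * |x t ω| ^ (-α) := fun t ω => by positivity
  refine isBigOInProbability_of_lintegral_le
    ((eventually_one_le_powerSumRate α).mono fun n hn => by linarith) fun δ hδ => ?_
  -- The first `t₀ - 1` terms, without a density bound, form one fixed random variable,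
  -- whatever its moments.
  set Z : Ω → ℝ := fun ω => ∑ t ∈ Finset.Icc 1 (t₀ - 1), |v t ω| * |x t ω| ^ (-α)
  have hZ : Measurable Z := Finset.measurable_fun_sum _ fun t ht =>
    (hv t (Finset.mem_Icc.1 ht).1).abs.mul ((hx t).abs.pow_const _)
  obtain ⟨M, hM, hZM⟩ := exists_measure_lt_abs_le hZ (half_pos hδ) (μ := μ)
  -- chosen so that `|x_t| ≤ e / √n` for some `t₀ ≤ t ≤ n` has probability at most `δ / 2`
  set e : ℝ := min 1 (δ / (8 * K))
  have he : 0 < e := by positivity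
  obtain ⟨A, hA, hrate⟩ := exists_powerSumRate_bounds (α := α) he (min_le_left _ _)
  refine ⟨M + C * (2 * K * A + 1), by positivity, ?_⟩
  filter_upwards [eventually_ge_atTop 3, eventually_ge_atTop t₀, eventually_one_le_powerSumRate α]
    with n hn3 hnt hn1
  obtain ⟨hr1, hr2⟩ := hrate n hn3
  have hn0 : (1 : ℝ) ≤ n := by exact_mod_cast (by omega : 1 ≤ n)
  have hs1 : 1 ≤ √(n : ℝ) := Real.one_le_sqrt.2 hn0
  have hs : 0 < √(n : ℝ) := by linarith
  set κ := e / √(n : ℝ)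
  have hκ : 0 < κ := by positivity
  have hκR : κ ≤ √(n : ℝ) :=
    (div_le_self he.le hs1).trans ((min_le_left _ _).trans hs1)
  set I := 2 * ∫ y in κ..√(n : ℝ), y ^ (-α)
  have hI : 0 ≤ I := mul_nonneg two_pos.le
    (intervalIntegral.integral_nonneg hκR fun y hy => Real.rpow_nonneg (hκ.le.trans hy.1) _)
  set g : ℝ → ℝ≥0∞ := {y : ℝ | κ < |y|}.indicator fun y => ENNReal.ofReal (|y| ^ (-α))
  have hg : Measurable g := Measurable.indicator (by fun_prop)
    (measurableSet_lt measurable_const measurable_id.abs)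
  have hf : ∀ t ∈ Finset.Icc t₀ n, Measurable fun ω => ENNReal.ofReal |v t ω| * g (x t ω) :=
    fun t ht => (hv t (ht₀.trans (Finset.mem_Icc.1 ht).1)).abs.ennreal_ofReal.mul (hg.comp (hx t))
  refine ⟨{ω | |Z ω| ≤ M} ∩ {ω | ∀ t ∈ Finset.Icc t₀ n, κ < |x t ω|},
    fun ω => ENNReal.ofReal M + ∑ t ∈ Finset.Icc t₀ n, ENNReal.ofReal |v t ω| * g (x t ω),
    ?_, measurable_const.add (Finset.measurable_fun_sum _ hf), ?_, ?_⟩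
  · have hsub : ({ω | |Z ω| ≤ M} ∩ {ω | ∀ t ∈ Finset.Icc t₀ n, κ < |x t ω|})ᶜ
        ⊆ {ω | M < |Z ω|} ∪ {ω | ∃ t ∈ Finset.Icc t₀ n, |x t ω| ≤ κ} := by
      intro ω hω
      rw [Set.compl_inter] at hω
      refine Set.union_subset_union (fun ω h => ?_) (fun ω h => ?_) hω
      · simpa only [Set.mem_compl_iff, Set.mem_ofPred_eq, not_le] using h
      · simpa only [Set.mem_compl_iff, Set.mem_ofPred_eq, not_forall, not_lt, exists_prop] using h
    refine (measure_mono hsub).trans ((measure_union_le _ _).trans ?_)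
    refine (add_le_add hZM (measure_exists_abs_le_le hx hK ht₀ hlaw he n)).trans ?_
    rw [← ENNReal.ofReal_add (by positivity) (by positivity)]
    refine ENNReal.ofReal_le_ofReal ?_
    have : 4 * K * e ≤ 4 * K * (δ / (8 * K)) := by gcongr; exact min_le_right _ _
    have h2 : 4 * K * (δ / (8 * K)) = δ / 2 := by field_simp; ring
    linarith
  · rintro ω ⟨hωZ, hωx⟩
    have hsplit : ∑ t ∈ Finset.Icc 1 n, |v t ω| * |x t ω| ^ (-α)
        = Z ω + ∑ t ∈ Finset.Icc t₀ n, |v t ω| * |x t ω| ^ (-α) := by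
      rw [← Finset.sum_union]
      · congr 1
        ext t
        simp only [Finset.mem_union, Finset.mem_Icc]
        omega
      · rw [Finset.disjoint_left]
        intro t
        simp only [Finset.mem_Icc]
        omega
    rw [abs_of_nonneg (Finset.sum_nonneg fun t _ => hterm t ω), hsplit,
      ENNReal.ofReal_add (Finset.sum_nonneg fun t _ => hterm t ω)
        (Finset.sum_nonneg fun t _ => hterm t ω),
      ENNReal.ofReal_sum_of_nonneg (s := Finset.Icc t₀ n) fun t _ => hterm t ω]
    refine add_le_add (ENNReal.ofReal_le_ofReal ((le_abs_self _).trans hωZ))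
      (Finset.sum_le_sum fun t ht => le_of_eq ?_)
    rw [ENNReal.ofReal_mul (abs_nonneg _)]
    congr 1
    exact (Set.indicator_of_mem (show x t ω ∈ {y : ℝ | κ < |y|} from hωx t ht)
      fun y => ENNReal.ofReal (|y| ^ (-α))).symm
  · have hone : ∀ t ∈ Finset.Icc t₀ n, ∫⁻ ω, ENNReal.ofReal |v t ω| * g (x t ω) ∂μ
        ≤ ENNReal.ofReal (C * (K / √t * I + √(n : ℝ) ^ (-α))) := by
      intro t ht
      have ht1 : 1 ≤ t := ht₀.trans (Finset.mem_Icc.1 ht).1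
      have : IsProbabilityMeasure (μ.map (x t)) :=
        Measure.isProbabilityMeasure_map (hx t).aemeasurable
      rw [lintegral_abs_mul_comp_of_condExp_eq (hv t ht1) (hvi t ht1) (hx t) (hcond t ht1) hg,
        ← lintegral_map hg (hx t), ENNReal.ofReal_mul hC]
      exact mul_le_mul' (ENNReal.ofReal_le_ofReal (hvC t ht1))
        (lintegral_truncated_rpow_le (by positivity) (hlaw t (Finset.mem_Icc.1 ht).1) hκ hκR hα)
    rw [lintegral_add_left measurable_const, lintegral_const, measure_univ, mul_one,
      lintegral_finsetSum _ hf]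
    refine (add_le_add_right (Finset.sum_le_sum hone) _).trans ?_
    have hnn : ∀ t : ℕ, 0 ≤ C * (K / √(t : ℝ) * I + √(n : ℝ) ^ (-α)) := fun t => by positivity
    rw [← ENNReal.ofReal_sum_of_nonneg fun t _ => hnn t,
      ← ENNReal.ofReal_add hM.le (Finset.sum_nonneg fun t _ => hnn t)]
    refine ENNReal.ofReal_le_ofReal ?_
    have hsum : ∑ t ∈ Finset.Icc t₀ n, C * (K / √(t : ℝ) * I + √(n : ℝ) ^ (-α))
        ≤ C * (2 * K * A + 1) * powerSumRate α n := by
      calc ∑ t ∈ Finset.Icc t₀ n, C * (K / √(t : ℝ) * I + √(n : ℝ) ^ (-α))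
          ≤ ∑ t ∈ Finset.Icc 1 n, C * (K / √(t : ℝ) * I + √(n : ℝ) ^ (-α)) :=
            Finset.sum_le_sum_of_subset_of_nonneg (Finset.Icc_subset_Icc_left ht₀)
              fun t _ _ => hnn t
        _ = C * (K * I * ∑ t ∈ Finset.Icc 1 n, (√(t : ℝ))⁻¹ + n * √(n : ℝ) ^ (-α)) := by
            rw [← Finset.mul_sum, Finset.sum_add_distrib, Finset.sum_const, Nat.card_Icc,
              nsmul_eq_mul, Finset.mul_sum, Nat.add_sub_cancel]
            congr 2
            exact Finset.sum_congr rfl fun t _ => by ring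
        _ ≤ C * (K * I * (2 * √(n : ℝ)) + powerSumRate α n) := by
            gcongr; exact sum_inv_sqrt_le n
        _ = C * (2 * K * (√(n : ℝ) * I) + powerSumRate α n) := by ring
        _ ≤ C * (2 * K * (A * powerSumRate α n) + powerSumRate α n) := by gcongr
        _ = _ := by ring
    have hMr : M ≤ M * powerSumRate α n := le_mul_of_one_le_right hM.le hn1
    calc _ ≤ M * powerSumRate α n + C * (2 * K * A + 1) * powerSumRate α n := add_le_add hMr hsum
      _ = _ := by ring

theorem rpow_le_mul_one_add_sq_div {y r p : ℝ} (hy : 0 ≤ y) (hr : 0 < r) (hp0 : 0 ≤ p)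
    (hp2 : p ≤ 2) : y ^ p ≤ r ^ p * (1 + y ^ 2 / r ^ 2) := by
  have h1 : y = r * (y / r) := by field_simp
  have h2 : 0 ≤ y / r := by positivity
  have h3 : (y / r) ^ p ≤ 1 + (y / r) ^ 2 := by
    rcases le_total (y / r) 1 with h | h
    · exact (Real.rpow_le_one h2 h hp0).trans (by linarith [sq_nonneg (y / r)])
    · have := Real.rpow_le_rpow_of_exponent_le h hp2
      rw [Real.rpow_two] at this
      linarith
  calc y ^ p = r ^ p * (y / r) ^ p := by rw [← Real.mul_rpow hr.le h2, ← h1]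
    _ ≤ r ^ p * (1 + (y / r) ^ 2) := by gcongr
    _ = _ := by rw [div_pow]

/-- The rates for `-2 ≤ α < 0`: only second moments of `S t` are used, and `x₀` need not have any
moment. -/
theorem isBigOInProbability_sum_of_neg [IsProbabilityMeasure μ]
    {x₀ : Ω → ℝ} {x v S : ℕ → Ω → ℝ} (hx₀ : Measurable x₀)
    (hS : ∀ t, Measurable (S t)) (hxS : ∀ t ω, x t ω = x₀ ω + S t ω) {B : ℝ} (hB : 0 ≤ B)
    (hS2 : ∀ t : ℕ, ∫⁻ ω, ENNReal.ofReal (S t ω ^ 2) ∂μ ≤ ENNReal.ofReal (B * t))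
    {α : ℝ} (hα : -2 ≤ α) (hα0 : α < 0) (hv : ∀ t, 1 ≤ t → Measurable (v t))
    (hvi : ∀ t, 1 ≤ t → Integrable (v t) μ) {C : ℝ}
    (hvC : ∀ t, 1 ≤ t → ∫ ω, |v t ω| ∂μ ≤ C)
    (hcond : ∀ t, 1 ≤ t →
      μ[fun ω => |v t ω| | MeasurableSpace.comap (S t) inferInstance]
        =ᵐ[μ] fun _ => ∫ ω, |v t ω| ∂μ) :
    IsBigOInProbability μ (fun n ω => ∑ t ∈ Finset.Icc 1 n, |v t ω| * |x t ω| ^ (-α))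
      (powerSumRate α) := by
  have hC : 0 ≤ C := (integral_nonneg fun ω => abs_nonneg _).trans (hvC 1 le_rfl)
  refine isBigOInProbability_of_lintegral_le
    ((eventually_one_le_powerSumRate α).mono fun n hn => by linarith) fun δ hδ => ?_
  obtain ⟨M, hM, hxM⟩ := exists_measure_lt_abs_le hx₀ hδ (μ := μ)
  refine ⟨C * (1 + 2 * M ^ 2 + 2 * B) + 1, by positivity, ?_⟩
  filter_upwards [eventually_ge_atTop 1] with n hn
  have hn0 : (0 : ℝ) < n := by exact_mod_cast hn
  -- all terms are compared on the common scale `√n`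
  set q : ℝ := √(n : ℝ) ^ (-α)
  have hq : 0 ≤ q := by positivity
  have hrate : powerSumRate α n = n * q := by
    rw [powerSumRate, if_neg (by linarith), if_neg (by linarith)]
    simp only [q]
    rw [Real.sqrt_eq_rpow, ← Real.rpow_mul hn0.le, ← Real.rpow_one_add' hn0.le (by linarith)]
    congr 1; ring
  set g : ℝ → ℝ≥0∞ := fun y => ENNReal.ofReal q *
    (ENNReal.ofReal (1 + 2 * M ^ 2) + ENNReal.ofReal (2 / n) * ENNReal.ofReal (y ^ 2))
  have hg : Measurable g := by fun_prop
  have hf : ∀ t ∈ Finset.Icc 1 n, Measurable fun ω => ENNReal.ofReal |v t ω| * g (S t ω) :=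
    fun t ht => (hv t (Finset.mem_Icc.1 ht).1).abs.ennreal_ofReal.mul (hg.comp (hS t))
  refine ⟨{ω | |x₀ ω| ≤ M}, fun ω => ∑ t ∈ Finset.Icc 1 n, ENNReal.ofReal |v t ω| * g (S t ω),
    ?_, Finset.measurable_fun_sum _ hf, ?_, ?_⟩
  · refine (measure_mono fun ω hω => ?_).trans hxM
    simpa only [Set.mem_compl_iff, Set.mem_ofPred_eq, not_le] using hω
  · intro ω hω
    have hterm : ∀ t, 0 ≤ |v t ω| * |x t ω| ^ (-α) := fun t => by positivity
    rw [abs_of_nonneg (Finset.sum_nonneg fun t _ => hterm t),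
      ENNReal.ofReal_sum_of_nonneg fun t _ => hterm t]
    refine Finset.sum_le_sum fun t _ => ?_
    rw [ENNReal.ofReal_mul (abs_nonneg _)]
    refine mul_le_mul_right ?_ _
    simp only [g]
    rw [← ENNReal.ofReal_mul (by positivity), ← ENNReal.ofReal_add (by positivity) (by positivity),
      ← ENNReal.ofReal_mul hq]
    refine ENNReal.ofReal_le_ofReal ?_
    refine (rpow_le_mul_one_add_sq_div (abs_nonneg _) (Real.sqrt_pos.2 hn0) (by linarith)
      (by linarith)).trans ?_
    refine mul_le_mul_of_nonneg_left ?_ hq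
    rw [Real.sq_sqrt hn0.le, sq_abs, hxS]
    have h1 : x₀ ω ^ 2 ≤ M ^ 2 := sq_le_sq' (neg_le_of_abs_le hω) (le_of_abs_le hω)
    have h2 : (x₀ ω + S t ω) ^ 2 ≤ 2 * M ^ 2 + 2 * S t ω ^ 2 := by
      nlinarith [sq_nonneg (x₀ ω - S t ω)]
    have h3 : 2 * M ^ 2 / n ≤ 2 * M ^ 2 :=
      div_le_self (by positivity) (by exact_mod_cast hn)
    calc 1 + (x₀ ω + S t ω) ^ 2 / n ≤ 1 + (2 * M ^ 2 + 2 * S t ω ^ 2) / n := by gcongr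
      _ = 1 + 2 * M ^ 2 / n + 2 / n * S t ω ^ 2 := by ring
      _ ≤ _ := by linarith
  · have hone : ∀ t ∈ Finset.Icc 1 n, ∫⁻ ω, ENNReal.ofReal |v t ω| * g (S t ω) ∂μ
        ≤ ENNReal.ofReal (C * (q * (1 + 2 * M ^ 2 + 2 * B))) := by
      intro t ht
      obtain ⟨ht1, htn⟩ := Finset.mem_Icc.1 ht
      rw [lintegral_abs_mul_comp_of_condExp_eq (hv t ht1) (hvi t ht1) (hS t) (hcond t ht1) hg,
        ENNReal.ofReal_mul hC]
      refine mul_le_mul' (ENNReal.ofReal_le_ofReal (hvC t ht1)) ?_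
      simp only [g]
      rw [lintegral_const_mul' _ _ ENNReal.ofReal_ne_top, lintegral_add_left measurable_const,
        lintegral_const, measure_univ, mul_one, lintegral_const_mul' _ _ ENNReal.ofReal_ne_top,
        ENNReal.ofReal_mul hq,
        ENNReal.ofReal_add (p := 1 + 2 * M ^ 2) (by positivity) (by positivity)]
      refine mul_le_mul_right (add_le_add_right ?_ _) _
      refine (mul_le_mul_right (hS2 t) _).trans ?_
      rw [← ENNReal.ofReal_mul (by positivity)]
      refine ENNReal.ofReal_le_ofReal ?_
      have htn' : (t : ℝ) ≤ n := by exact_mod_cast htn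
      calc 2 / (n : ℝ) * (B * t) ≤ 2 / (n : ℝ) * (B * n) := by gcongr
        _ = 2 * B := by field_simp
    rw [lintegral_finsetSum _ hf]
    refine (Finset.sum_le_sum hone).trans ?_
    rw [Finset.sum_const, Nat.card_Icc, Nat.add_sub_cancel, nsmul_eq_mul,
      ← ENNReal.ofReal_natCast, ← ENNReal.ofReal_mul hn0.le, hrate]
    refine ENNReal.ofReal_le_ofReal ?_
    have : 0 ≤ n * q := by positivity
    linarith

end

/-! ### Rates for the integrated process -/

theorem proposition2 {Ω : Type*} [MeasurableSpace Ω] (μ : Measure Ω) [IsProbabilityMeasure μ]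
    -- the innovations: i.i.d., mean zero, variance one, with a density and
    -- a characteristic function some power of whose modulus is integrable
    (ε : ℤ → Ω → ℝ) (hε_meas : ∀ i, Measurable (ε i))
    (hε_indep : iIndepFun ε μ) (hε_ident : ∀ i, IdentDistrib (ε i) (ε 0) μ μ)
    (hε_memLp : MemLp (ε 0) 2 μ) (hε_mean : ∫ ω, ε 0 ω ∂μ = 0) (hε_var : Var[ε 0; μ] = 1)
    (hε_pdf : HasPDF (ε 0) μ volume)
    (hε_char : ∃ ν : ℝ, 1 ≤ ν ∧
      Integrable (fun s : ℝ => ‖charFun (μ.map (ε 0)) s‖ ^ ν) volume)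
    -- the coefficients
    (φ : ℕ → ℝ) (hφ_summable : Summable (fun j => |φ j|)) (hφ_sum : ∑' j, φ j ≠ 0)
    -- the linear process, the initial value and the integrated process
    (w : ℕ → Ω → ℝ) (hw : w = linearProcess φ ε)
    (x₀ : Ω → ℝ) (hx₀_meas : Measurable x₀)
    (hx₀_indep : IndepFun x₀ (fun ω (t : {t : ℕ // 1 ≤ t}) => w t ω) μ)
    (x : ℕ → Ω → ℝ) (hx : x = integratedProcess x₀ w)
    -- the weights
    (α : ℝ) (hα : -2 ≤ α)
    (v : ℕ → Ω → ℝ) (hv_meas : ∀ t, 1 ≤ t → Measurable (v t))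
    (hv_int : ∀ t, 1 ≤ t → Integrable (v t) μ)
    (hv_bdd : ∃ C : ℝ, ∀ t, 1 ≤ t → ∫ ω, |v t ω| ∂μ ≤ C)
    (hv_nonneg : 0 ≤ α → ∀ t, 1 ≤ t →
      μ[fun ω => |v t ω| | MeasurableSpace.comap (x t) inferInstance]
        =ᵐ[μ] fun _ => ∫ ω, |v t ω| ∂μ)
    (hv_neg : α < 0 → ∀ t, 1 ≤ t →
      μ[fun ω => |v t ω| | MeasurableSpace.comap (fun ω => x t ω - x₀ ω) inferInstance]
        =ᵐ[μ] fun _ => ∫ ω, |v t ω| ∂μ) :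
    -- almost surely the powers are evaluated away from zero, so that the sums are well defined
    (∀ᵐ ω ∂μ, ∀ t, 1 ≤ t → x t ω ≠ 0) ∧
    IsBigOInProbability μ (fun n ω => ∑ t ∈ Finset.Icc 1 n, |v t ω| * |x t ω| ^ (-α))
      (powerSumRate α) ∧
    IsBigOInProbability μ (fun n ω => ∑ t ∈ Finset.Icc 1 n, v t ω * |x t ω| ^ (-α))
      (powerSumRate α) := by
  obtain ⟨ν, hν, hchar⟩ := hε_char
  obtain ⟨C, hvC⟩ := hv_bdd
  have hac : μ.map (ε 0) ≪ volume := hε_pdf.absolutelyContinuous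
  have hint : Integrable (ε 0) μ := hε_memLp.integrable (by norm_num)
  have h1 : ∫ ω, (ε 0 ^ 2) ω ∂μ = 1 := by
    rw [← hε_var, variance_of_integral_eq_zero (hε_meas 0).aemeasurable hε_mean]
    rfl
  set S : ℕ → Ω → ℝ := fun t ω => ∑ k ∈ Finset.Icc 1 t, w k ω
  have hwm : ∀ t, Measurable (w t) := fun t => hw ▸ measurable_linearProcess φ hε_meas t
  have hSm : ∀ t, Measurable (S t) := fun t => Finset.measurable_fun_sum _ fun k _ => hwm k
  have hxS : ∀ t ω, x t ω = x₀ ω + S t ω := fun t ω => by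
    rw [hx, integratedProcess_eq_add_sum]
  have hxS' : ∀ t, x t = S t + x₀ := fun t => by
    funext ω
    rw [hxS, Pi.add_apply, add_comm]
  have hxm : ∀ t, Measurable (x t) := fun t => hx ▸ measurable_integratedProcess hx₀_meas hwm t
  have hSx₀ : ∀ t, IndepFun (S t) x₀ μ := by
    intro t
    have hm : Measurable fun (z : {t : ℕ // 1 ≤ t} → ℝ) =>
        ∑ k ∈ (Finset.Icc 1 t).attach, z ⟨k, (Finset.mem_Icc.1 k.2).1⟩ :=
      Finset.measurable_fun_sum _ fun k _ => measurable_pi_apply _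
    have h := (hx₀_indep.comp measurable_id hm).symm
    convert! h using 1
    funext ω
    exact (Finset.sum_attach (Finset.Icc 1 t) fun k => w k ω).symm
  have hO : IsBigOInProbability μ (fun n ω => ∑ t ∈ Finset.Icc 1 n, |v t ω| * |x t ω| ^ (-α))
      (powerSumRate α) := by
    rcases le_or_gt 0 α with hα0 | hα0
    · obtain ⟨K, hK, t₀, ht₀, hlaw⟩ := exists_map_sum_linearProcess_le hε_meas hε_indep hε_ident
        hint hε_mean h1 hac (zero_le_one.trans hν) hchar hφ_summable hφ_sum
      refine isBigOInProbability_sum_of_nonneg hxm hK ht₀ (fun t ht => ?_) hα0 hv_meas hv_int hvC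
        (hv_nonneg hα0)
      rw [hxS']
      refine IndepFun.map_add_le_smul_volume (hSm t) hx₀_meas (hSx₀ t) ?_
      simp only [S, hw]
      exact hlaw t ht
    · refine isBigOInProbability_sum_of_neg hx₀_meas hSm hxS
        (B := (∑' j, |φ j|) ^ 2) (by positivity) (fun t => ?_) hα hα0 hv_meas hv_int hvC
        fun t ht => ?_
      · simp only [S, hw]
        exact lintegral_sq_sum_linearProcess_le hε_meas hε_indep hε_ident hε_memLp hε_mean hε_var
          hφ_summable t
      · have hdiff : (fun ω => x t ω - x₀ ω) = S t := by
          funext ω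
          rw [hxS, add_sub_cancel_left]
        have := hv_neg hα0 t ht
        rwa [hdiff] at this
  refine ⟨ae_all_iff.2 fun t => ?_, hO, hO.mono fun n ω => ?_⟩
  · by_cases ht : 1 ≤ t
    · have hacx : μ.map (x t) ≪ volume := by
        rw [hxS']
        refine IndepFun.map_add_absolutelyContinuous (hSm t) hx₀_meas (hSx₀ t) ?_
        simp only [S, hw]
        exact map_sum_linearProcess_absolutelyContinuous hε_meas hε_indep hε_ident hint hac
          hφ_summable hφ_sum ht
      have h0 : μ (x t ⁻¹' {0}) = 0 := by
        rw [← Measure.map_apply (hxm t) (measurableSet_singleton 0)]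
        exact hacx Real.volume_singleton
      filter_upwards [measure_eq_zero_iff_ae_notMem.1 h0] with ω hω _
      exact hω
    · exact ae_of_all _ fun ω h => absurd h ht
  · rw [abs_of_nonneg (Finset.sum_nonneg fun t _ =>
      mul_nonneg (abs_nonneg _) (Real.rpow_nonneg (abs_nonneg _) _))]
    refine (Finset.abs_sum_le_sum_abs _ _).trans (Finset.sum_le_sum fun t _ => ?_)
    rw [abs_mul, abs_of_nonneg (Real.rpow_nonneg (abs_nonneg (x t ω)) _)]
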